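/- Let $\zeta$ be the Riemann zeta function, let $\rho$ run over its nontrivial zeros (the zeros other than $-2,-4,-6,\dots$), and let $\xi(z)=\tfrac12 z(z-1)\pi^{-z/2}\Gamma(z/2)\zeta(z)$, extended to an entire function. For real $a>1/4$ and integers $n\ge 1$, $0\le k\le n$, put $$A_{k,n}=a^{2k-2n}\sum_{l=k}^{n}\binom{2n}{2l}\binom{l}{k},\qquad F_{2n}(z)=4\sum_{k=0}^{n-1}(n-k)A_{k,n}\,(z-1/2)^{2k}.$$ Then, with the principal branches of the square root and of the logarithm, $\ln\xi$ is analytic near $z=1/2$. For all $a>1/4$ and $n\ge1$ the two sums $$S_n(a)=\sum_\rho\left[\left(1-\left(\frac{1+\sqrt{1+a^2(\rho-1/2)^2}}{a(\rho-1/2)}\right)^{2n}\right)+\left(1-\left(\frac{1-\sqrt{1+a^2(\rho-1/2)^2}}{a(\rho-1/2)}\right)^{2n}\right)\right],$$ $$T_n(a)=\sum_\rho\left(1-(\rho-1/2)^{-2n}\sum_{k=0}^{n}A_{k,n}(\rho-1/2)^{2k}\right),$$ in which each zero is counted with its multiplicity, converge absolutely; each summand of $S_n(a)$ is twice the corresponding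 summand of $T_n(a)$; and $S_n(a)$, $T_n(a)$ and $$D_n(a)=\frac{1}{(2n-1)!}\,\frac{d^{2n}}{dz^{2n}}\Bigl(F_{2n}(z)\ln\xi(z)\Bigr)\Big|_{z=1/2}$$ are real numbers. Moreover, for every fixed real $a>1/4$ the following are equivalent: 1. the Riemann hypothesis; 2. $S_n(a)\ge 0$ for all $n\ge1$; 3. $T_n(a)\ge 0$ for all $n\ge1$; 4. $D_n(a)\ge 0$ for all $n\ge1$. The Riemann hypothesis is likewise equivalent to each of 2, 3, 4 being required for all real $a>1/4$ and all $n\ge1$ together. -/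

import Mathlib

noncomputable section

namespace VorosCriterion

/-- The nontrivial zeros of the Riemann zeta function: all zeros other than `-2, -4, -6, …`.
(The point `1` is the pole, where Mathlib's function takes a conventional value.) -/
def nontrivialZeros : Set ℂ :=
  {ρ | riemannZeta ρ = 0 ∧ (¬∃ n : ℕ, ρ = -2 * ((n : ℂ) + 1)) ∧ ρ ≠ 1}

/-- The multiplicity of `ρ` as a zero of the Riemann zeta function. -/
def zeroMultiplicity (ρ : ℂ) : ℕ := analyticOrderNatAt riemannZeta ρ

/-- The Riemann xi function `ξ(z) = (1/2) z (z-1) π^(-z/2) Γ(z/2) ζ(z)`, written as an entire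
function, without removable singularities, through the entire function
`Λ₀(z) = π^(-z/2) Γ(z/2) ζ(z) + 1/z + 1/(1-z)`. -/
def riemannXi (z : ℂ) : ℂ :=
  (1 / 2) * (z * (z - 1) * completedRiemannZeta₀ z + 1)

/-- The usual formula for `ξ`, at all points where no factor is singular. -/
theorem riemannXi_eq {z : ℂ} (h1 : z ≠ 1) (h : ∀ n : ℕ, z / 2 ≠ -(n : ℂ)) :
    riemannXi z = (1 / 2) * z * (z - 1) * (Real.pi : ℂ) ^ (-z / 2) * Complex.Gamma (z / 2)
      * riemannZeta z := by
  have h0 : z ≠ 0 := by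
    rintro rfl
    exact h 0 (by simp)
  have h1' : (1 : ℂ) - z ≠ 0 := sub_ne_zero.mpr (Ne.symm h1)
  have hG : Complex.Gamma (z / 2) ≠ 0 := Complex.Gamma_ne_zero h
  have hpi : (Real.pi : ℂ) ^ (-z / 2) ≠ 0 := by
    rw [Complex.cpow_ne_zero_iff]
    left
    exact_mod_cast Real.pi_ne_zero
  rw [riemannZeta_def_of_ne_zero h0, completedRiemannZeta_eq, Complex.Gammaℝ_def, riemannXi]
  field_simp
  ring

/-- The coefficient
`A_{k,n} = a^(2k-2n) ∑_{l=k}^{n} C(2n,2l) C(l,k)`. -/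
def coeffA (a : ℝ) (k n : ℕ) : ℝ :=
  a ^ (2 * (k : ℤ) - 2 * (n : ℤ)) *
    ∑ l ∈ Finset.Icc k n, ((2 * n).choose (2 * l) : ℝ) * (l.choose k : ℝ)

/-- The polynomial `F_{2n}(z) = 4 ∑_{k=0}^{n-1} (n-k) A_{k,n} (z-1/2)^(2k)`. -/
def polyF (a : ℝ) (n : ℕ) (z : ℂ) : ℂ :=
  4 * ∑ k ∈ Finset.range n, ((n : ℂ) - (k : ℂ)) * (coeffA a k n : ℂ) * (z - 1 / 2) ^ (2 * k)

/-- The contribution of one zero `ρ` to the Voros sum, with the principal square root. -/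
def vorosTerm (a : ℝ) (n : ℕ) (ρ : ℂ) : ℂ :=
  (1 - ((1 + Complex.sqrt (1 + (a : ℂ) ^ 2 * (ρ - 1 / 2) ^ 2)) / ((a : ℂ) * (ρ - 1 / 2))) ^ (2 * n))
  + (1 - ((1 - Complex.sqrt (1 + (a : ℂ) ^ 2 * (ρ - 1 / 2) ^ 2)) / ((a : ℂ) * (ρ - 1 / 2))) ^ (2 * n))

/-- The contribution of one zero `ρ` to the square-root-free sum. -/
def powerTerm (a : ℝ) (n : ℕ) (ρ : ℂ) : ℂ :=
  1 - ((ρ - 1 / 2) ^ (2 * n))⁻¹ *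
    ∑ k ∈ Finset.range (n + 1), (coeffA a k n : ℂ) * (ρ - 1 / 2) ^ (2 * k)

/-- The Voros sum over all nontrivial zeros, counted with multiplicity. -/
def vorosSum (a : ℝ) (n : ℕ) : ℂ :=
  ∑' ρ : nontrivialZeros, (zeroMultiplicity ρ : ℂ) * vorosTerm a n ρ

/-- The square-root-free sum over all nontrivial zeros, counted with multiplicity. -/
def powerSum (a : ℝ) (n : ℕ) : ℂ :=
  ∑' ρ : nontrivialZeros, (zeroMultiplicity ρ : ℂ) * powerTerm a n ρ

/-- The number `(1/(2n-1)!) d^(2n)/dz^(2n) (F_{2n}(z) ln ξ(z))` at `z = 1/2`. -/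
def xiDerivative (a : ℝ) (n : ℕ) : ℂ :=
  (1 / ((2 * n - 1).factorial : ℂ)) *
    iteratedDeriv (2 * n) (fun z : ℂ => polyF a n z * Complex.log (riemannXi z)) (1 / 2)

end VorosCriterion

end

/-!
Write `w = ρ - 1/2` for a nontrivial zero `ρ`. The two bases in a summand of the Voros sum have
product `-1`, and the square `y` of either of them satisfies `y + 1/y = 2 + 4 / (a w)²`. Hence the
summand of the square-root-free sum is `1 - (y^n + y^(-n)) / 2`, half the corresponding summand of
the Voros sum (`powerTerm_eq_of_add_inv`, `vorosTerm_eq`).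

*The Riemann hypothesis implies nonnegativity.* If `w = iγ` with `|γ| ≥ 1/a`, then `y` lies on the
unit circle and the summand is `1 - cos (nθ) ≥ 0` (`powerTerm_re_nonneg`). As `a > 1/4`, it suffices
that there is no zero on the critical line with `|γ| < 4`. Now `ξ(ρ) = 0` reads
`ρ (ρ - 1) Λ₀(ρ) = -1`, where `Λ₀` is the entire completed zeta function. It is the Mellin transform
of a nonnegative function, so `|Λ₀|` in the critical strip is at most
`Λ₀(1) = 1 + (γ - log 4π) / 2 ≤ 4/65`, by convexity and the functional equation
(`norm_completedRiemannZeta₀_le`, `norm_mul_sub_one_ge_of_mem`).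

*Nonnegativity implies the Riemann hypothesis.* A zero off the critical line has `|y| > 1` for one
of its two values of `y`. Only finitely many zeros have the largest `|y| = R`, and along infinitely
many `n` their `y^n` are simultaneously near `R^n`, so that the sum is below `-c R^n`
(`exists_re_tsum_neg`, after Bombieri and Lagarias).

*Derivatives of `ln ξ`.* Comparing coefficients, the derivative is `4n` times the square-root-free
sum as soon as the Taylor coefficients of `ln ξ` at `1/2` of degree at least two are power sums of
the `w` (`xiDerivative_eq`). This follows, without Hadamard's factorization theorem, for every
entire function with growth `exp (C R^(3/2))` (`factorial_mul_tsum_eq`): divide it by its zeros in a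
disc of radius `R`; the maximum principle bounds the quotient, the Borel–Carathéodory theorem bounds
the logarithm of the quotient, and Cauchy's estimates make the higher Taylor coefficients of this
logarithm tend to `0` as `R → ∞`. The same division gives Jensen's inequality for the number of
zeros, hence the absolute convergence of all sums (`summable_order_div_sq`). The growth of `ξ` is
read off from `Λ₀` at large even integers (`exists_norm_riemannXi_le`).
-/

noncomputable section

namespace VorosCriterion

open Complex MeasureTheory Set Filter Topology

/-! ### The completed zeta function as a Mellin transform of a nonnegative function -/

lemma one_le_evenKernel_zero {x : ℝ} (hx : 0 < x) : 1 ≤ HurwitzZeta.evenKernel 0 x := by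
  have h := HurwitzZeta.hasSum_int_evenKernel₀ 0 hx
  have h0 := h.nonneg fun n => by split_ifs <;> positivity
  simp at h0
  exact h0

/-- The function `θ(x) - 1` (for `x > 1`), `θ(x) - x^(-1/2)` (for `x < 1`), whose Mellin transform
is the entire completed zeta function, takes nonnegative real values. -/
lemma f_modif_eq_ofReal_norm {x : ℝ} (hx : 0 < x) :
    ((HurwitzZeta.hurwitzEvenFEPair 0).f_modif x) =
      ((‖(HurwitzZeta.hurwitzEvenFEPair 0).f_modif x‖ : ℝ) : ℂ) := by
  suffices h : ∃ r : ℝ, 0 ≤ r ∧ (HurwitzZeta.hurwitzEvenFEPair 0).f_modif x = (r : ℂ) by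
    obtain ⟨r, hr, h⟩ := h
    rw [h, norm_real, Real.norm_of_nonneg hr]
  rcases lt_trichotomy 1 x with h1 | rfl | h1
  · refine ⟨HurwitzZeta.evenKernel 0 x - 1, by linarith [one_le_evenKernel_zero hx], ?_⟩
    simp [WeakFEPair.f_modif, h1, h1.le, HurwitzZeta.hurwitzEvenFEPair]
  · exact ⟨0, le_rfl, by simp [WeakFEPair.f_modif]⟩
  · refine ⟨HurwitzZeta.evenKernel 0 x - x ^ (-(1 / 2) : ℝ), ?_, ?_⟩
    · rw [HurwitzZeta.evenKernel_functional_equation,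
        ← HurwitzZeta.evenKernel_eq_cosKernel_of_zero, Real.rpow_neg hx.le, ← one_div]
      have := one_le_evenKernel_zero (one_div_pos.mpr hx)
      have h2 : 0 < 1 / x ^ (1 / 2 : ℝ) := by positivity
      nlinarith
    · simp [WeakFEPair.f_modif, h1, h1.le, hx, HurwitzZeta.hurwitzEvenFEPair]

/-- The Mellin transform, at a real point, of the kernel of the completed zeta function. -/
def kernelMellin (σ : ℝ) : ℝ :=
  ∫ x in Ioi (0 : ℝ), x ^ (σ - 1) * ‖(HurwitzZeta.hurwitzEvenFEPair 0).f_modif x‖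

lemma norm_integrand_eq (s : ℂ) {x : ℝ} (hx : 0 < x) :
    ‖(x : ℂ) ^ (s - 1) • (HurwitzZeta.hurwitzEvenFEPair 0).f_modif x‖ =
      x ^ (s.re - 1) * ‖(HurwitzZeta.hurwitzEvenFEPair 0).f_modif x‖ := by
  rw [norm_smul, norm_cpow_eq_rpow_re_of_pos hx]
  simp

lemma integrableOn_kernelMellin (σ : ℝ) :
    IntegrableOn (fun x : ℝ => x ^ (σ - 1) * ‖(HurwitzZeta.hurwitzEvenFEPair 0).f_modif x‖)
      (Ioi 0) := by
  have h : MellinConvergent (HurwitzZeta.hurwitzEvenFEPair 0).f_modif (σ : ℂ) :=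
    (((HurwitzZeta.hurwitzEvenFEPair 0).isStrongFEPair_toStrongFEPair).hasMellin (σ : ℂ)).1
  refine (integrableOn_congr_fun (fun x hx => ?_) measurableSet_Ioi).mp h.norm
  simpa using norm_integrand_eq (σ : ℂ) hx

lemma norm_completedRiemannZeta₀_le_kernelMellin (s : ℂ) :
    ‖completedRiemannZeta₀ s‖ ≤ kernelMellin (s.re / 2) / 2 := by
  have h : completedRiemannZeta₀ s =
      mellin (HurwitzZeta.hurwitzEvenFEPair 0).f_modif (s / 2) / 2 := rfl
  rw [h, norm_div, norm_ofNat]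
  gcongr
  refine (norm_integral_le_integral_norm _).trans (le_of_eq ?_)
  refine setIntegral_congr_fun measurableSet_Ioi fun x hx => ?_
  have := norm_integrand_eq (s / 2) hx
  simpa using this

lemma completedRiemannZeta₀_ofReal (σ : ℝ) :
    completedRiemannZeta₀ σ = ((kernelMellin (σ / 2) / 2 : ℝ) : ℂ) := by
  have h : completedRiemannZeta₀ σ =
      mellin (HurwitzZeta.hurwitzEvenFEPair 0).f_modif (σ / 2) / 2 := rfl
  rw [h, ofReal_div, ofReal_ofNat, kernelMellin, ← integral_complex_ofReal]
  congr 1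
  refine setIntegral_congr_fun measurableSet_Ioi fun x hx => ?_
  have hx' : (0 : ℝ) < x := hx
  simp only [smul_eq_mul]
  rw [ofReal_mul, ← f_modif_eq_ofReal_norm hx', ofReal_cpow hx'.le]
  push_cast
  rfl

lemma kernelMellin_nonneg (σ : ℝ) : 0 ≤ kernelMellin σ :=
  setIntegral_nonneg measurableSet_Ioi fun x (hx : 0 < x) => by positivity

lemma norm_completedRiemannZeta₀_ofReal (σ : ℝ) :
    ‖completedRiemannZeta₀ σ‖ = kernelMellin (σ / 2) / 2 := by
  rw [completedRiemannZeta₀_ofReal, norm_real, Real.norm_of_nonneg]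
  have := kernelMellin_nonneg (σ / 2)
  positivity

lemma convexOn_kernelMellin : ConvexOn ℝ univ kernelMellin := by
  refine ⟨convex_univ, fun x _ y _ a b ha hb hab => ?_⟩
  simp only [smul_eq_mul, kernelMellin]
  rw [← integral_const_mul, ← integral_const_mul,
    ← integral_add ((integrableOn_kernelMellin x).const_mul a)
      ((integrableOn_kernelMellin y).const_mul b)]
  refine setIntegral_mono_on (integrableOn_kernelMellin _)
    (((integrableOn_kernelMellin x).const_mul a).add ((integrableOn_kernelMellin y).const_mul b))
    measurableSet_Ioi fun t (ht : 0 < t) => ?_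
  have h := Real.geom_mean_le_arith_mean2_weighted ha hb (Real.rpow_nonneg ht.le (x - 1))
    (Real.rpow_nonneg ht.le (y - 1)) hab
  rw [← Real.rpow_mul ht.le, ← Real.rpow_mul ht.le, ← Real.rpow_add ht] at h
  have he : (x - 1) * a + (y - 1) * b = a * x + b * y - 1 := by linear_combination -hab
  rw [he] at h
  calc _ ≤ (a * t ^ (x - 1) + b * t ^ (y - 1)) * _ :=
        mul_le_mul_of_nonneg_right h (norm_nonneg _)
    _ = _ := by ring

/-- Positivity of the kernel and convexity of its Mellin transform, with the functional equation,
bound the entire completed zeta function on a strip by its value at the real boundary point. -/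
lemma norm_completedRiemannZeta₀_le {s : ℂ} {τ : ℝ} (h1 : 1 - τ ≤ s.re) (h2 : s.re ≤ τ) :
    ‖completedRiemannZeta₀ s‖ ≤ ‖completedRiemannZeta₀ τ‖ := by
  refine (norm_completedRiemannZeta₀_le_kernelMellin s).trans ?_
  rw [norm_completedRiemannZeta₀_ofReal]
  have hsym : kernelMellin ((1 - τ) / 2) = kernelMellin (τ / 2) := by
    have h := completedRiemannZeta₀_one_sub (τ : ℂ)
    rw [completedRiemannZeta₀_ofReal, show (1 : ℂ) - τ = ((1 - τ : ℝ) : ℂ) by push_cast; rfl,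
      completedRiemannZeta₀_ofReal] at h
    have h' := ofReal_injective h
    linarith
  have := convexOn_kernelMellin.le_max_of_mem_Icc (mem_univ ((1 - τ) / 2)) (mem_univ (τ / 2))
    (z := s.re / 2) ⟨by linarith, by linarith⟩
  rw [hsym, max_self] at this
  linarith

lemma norm_completedRiemannZeta₀_one_le : ‖completedRiemannZeta₀ 1‖ ≤ 4 / 65 := by
  have h1 := norm_completedRiemannZeta₀_ofReal 1
  have h2 := completedRiemannZeta₀_ofReal 1
  rw [ofReal_one] at h1 h2
  have h3 : kernelMellin (1 / 2) / 2 =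
      (Real.eulerMascheroniConstant - Real.log (4 * Real.pi)) / 2 + 1 := by
    apply ofReal_injective
    rw [← h2, completedRiemannZeta₀_one]
    push_cast
    rw [ofReal_log (by positivity)]
    push_cast
    rfl
  rw [h1, h3]
  have h4 := Real.eulerMascheroniConstant_lt_eulerMascheroniSeq' 8
  have h5 : Real.eulerMascheroniSeq' 8 = 761 / 280 - Real.log 8 := by
    simp [Real.eulerMascheroniSeq', harmonic, Finset.sum_range_succ]
    norm_num
  have h6 : Real.log 8 = 3 * Real.log 2 := by
    rw [show (8 : ℝ) = 2 ^ 3 by norm_num, Real.log_pow]; norm_num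
  have h7 : Real.log (4 * Real.pi) = 2 * Real.log 2 + Real.log Real.pi := by
    rw [Real.log_mul (by norm_num) Real.pi_ne_zero, show (4 : ℝ) = 2 ^ 2 by norm_num, Real.log_pow]
    norm_num
  have h8 : (1.1291 : ℝ) ≤ Real.log Real.pi := by
    rw [Real.le_log_iff_exp_le Real.pi_pos, show (1.1291 : ℝ) = 1 + 0.1291 by norm_num,
      Real.exp_add]
    have e1 := Real.exp_one_lt_d9
    have e2 : Real.exp 0.1291 ≤ 1.1483 := by
      have h := Real.exp_bound_div_one_sub_of_interval (x := 0.1291) (by norm_num) (by norm_num)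
      exact h.trans (by norm_num)
    have e3 := Real.pi_gt_d2
    have e4 := Real.exp_pos 0.1291
    nlinarith
  have h9 := Real.log_two_gt_d9
  linarith

/-! ### The xi function and its zeros -/

lemma differentiable_riemannXi : Differentiable ℂ riemannXi := by
  have := differentiable_completedZeta₀
  unfold riemannXi
  fun_prop

lemma riemannXi_one_sub (z : ℂ) : riemannXi (1 - z) = riemannXi z := by
  simp only [riemannXi, completedRiemannZeta₀_one_sub]
  ring

lemma riemannXi_eq_completedRiemannZeta {z : ℂ} (h0 : z ≠ 0) (h1 : z ≠ 1) :
    riemannXi z = 1 / 2 * z * (z - 1) * completedRiemannZeta z := by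
  have : (1 : ℂ) - z ≠ 0 := sub_ne_zero.mpr (Ne.symm h1)
  rw [riemannXi, completedRiemannZeta_eq]
  field_simp
  ring

lemma riemannXi_ne_zero_of_one_le_re {z : ℂ} (hz : 1 ≤ z.re) : riemannXi z ≠ 0 := by
  rcases eq_or_ne z 1 with rfl | h1
  · simp [riemannXi]
  have h0 : z ≠ 0 := by rintro rfl; norm_num at hz
  rw [riemannXi_eq_completedRiemannZeta h0 h1]
  have h2 := riemannZeta_ne_zero_of_one_le_re hz
  rw [riemannZeta_def_of_ne_zero h0] at h2
  have h3 : completedRiemannZeta z ≠ 0 := fun h => h2 (by simp [h])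
  exact mul_ne_zero (mul_ne_zero (mul_ne_zero (by norm_num) h0) (sub_ne_zero.mpr h1)) h3

lemma riemannXi_ne_zero_of_re_nonpos {z : ℂ} (hz : z.re ≤ 0) : riemannXi z ≠ 0 := by
  rw [← riemannXi_one_sub]
  exact riemannXi_ne_zero_of_one_le_re (by simpa using hz)

/-- Away from `0` and `1`, the zeta function is `ξ` times an analytic factor, which vanishes
only at the trivial zeros. -/
lemma riemannZeta_eq_riemannXi_mul {z : ℂ} (h0 : z ≠ 0) (h1 : z ≠ 1) :
    riemannZeta z = riemannXi z * (2 / (z * (z - 1)) * (Gammaℝ z)⁻¹) := by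
  have := sub_ne_zero.mpr h1
  rw [riemannZeta_def_of_ne_zero h0, riemannXi_eq_completedRiemannZeta h0 h1]
  field_simp

lemma Gammaℝ_ne_zero_of_forall_ne {z : ℂ} (h0 : z ≠ 0)
    (h : ¬∃ n : ℕ, z = -2 * ((n : ℂ) + 1)) : Gammaℝ z ≠ 0 := by
  rw [Ne, Gammaℝ_eq_zero_iff]
  rintro ⟨n, hn⟩
  rcases n with _ | n
  · simp at hn; exact h0 hn
  · exact h ⟨n, by rw [hn]; push_cast; ring⟩

lemma mem_nontrivialZeros_iff {ρ : ℂ} : ρ ∈ nontrivialZeros ↔ riemannXi ρ = 0 := by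
  constructor
  · rintro ⟨hz, ht, h1⟩
    have h0 : ρ ≠ 0 := by rintro rfl; rw [riemannZeta_zero] at hz; norm_num at hz
    rw [riemannZeta_eq_riemannXi_mul h0 h1] at hz
    refine (mul_eq_zero.mp hz).resolve_right ?_
    exact mul_ne_zero (div_ne_zero two_ne_zero (mul_ne_zero h0 (sub_ne_zero.mpr h1)))
      (inv_ne_zero (Gammaℝ_ne_zero_of_forall_ne h0 ht))
  · intro h
    have hpos : 0 < ρ.re := by
      by_contra! hn
      exact riemannXi_ne_zero_of_re_nonpos hn h
    have hlt : ρ.re < 1 := by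
      by_contra! hn
      exact riemannXi_ne_zero_of_one_le_re hn h
    have h0 : ρ ≠ 0 := by rintro rfl; simp at hpos
    have h1 : ρ ≠ 1 := by rintro rfl; simp at hlt
    refine ⟨by rw [riemannZeta_eq_riemannXi_mul h0 h1, h, zero_mul], ?_, h1⟩
    rintro ⟨n, rfl⟩
    simp at hpos
    linarith [n.cast_nonneg (α := ℝ)]

lemma nontrivialZeros_eq : nontrivialZeros = {z | riemannXi z = 0} :=
  Set.ext fun _ => mem_nontrivialZeros_iff

lemma re_pos_of_mem {ρ : ℂ} (h : ρ ∈ nontrivialZeros) : 0 < ρ.re := by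
  by_contra! hn
  exact riemannXi_ne_zero_of_re_nonpos hn (mem_nontrivialZeros_iff.mp h)

lemma re_lt_one_of_mem {ρ : ℂ} (h : ρ ∈ nontrivialZeros) : ρ.re < 1 := by
  by_contra! hn
  exact riemannXi_ne_zero_of_one_le_re hn (mem_nontrivialZeros_iff.mp h)

lemma zeroMultiplicity_eq {ρ : ℂ} (h : ρ ∈ nontrivialZeros) :
    zeroMultiplicity ρ = analyticOrderNatAt riemannXi ρ := by
  have h0 : ρ ≠ 0 := by rintro rfl; simpa using re_pos_of_mem h
  have h1 : ρ ≠ 1 := h.2.2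
  let u : ℂ → ℂ := fun z => 2 / (z * (z - 1)) * (Gammaℝ z)⁻¹
  have hopen : IsOpen ({0, 1}ᶜ : Set ℂ) := (Set.toFinite _).isClosed.isOpen_compl
  have hmem : ρ ∈ ({0, 1}ᶜ : Set ℂ) := by simp [h0, h1]
  have hu : AnalyticAt ℂ u ρ := by
    have hd : DifferentiableOn ℂ u {0, 1}ᶜ := by
      intro z hz
      simp only [mem_compl_iff, mem_insert_iff, mem_singleton_iff, not_or] at hz
      have hz' : z * (z - 1) ≠ 0 := mul_ne_zero hz.1 (sub_ne_zero.mpr hz.2)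
      have hd : DifferentiableAt ℂ (fun z : ℂ => z * (z - 1)) z := by fun_prop
      exact (((differentiableAt_const 2).div hd hz').mul
        differentiable_Gammaℝ_inv.differentiableAt).differentiableWithinAt
    exact hd.analyticAt (hopen.mem_nhds hmem)
  have hu0 : u ρ ≠ 0 := by
    exact mul_ne_zero (div_ne_zero two_ne_zero (mul_ne_zero h0 (sub_ne_zero.mpr h1)))
      (inv_ne_zero (Gammaℝ_ne_zero_of_forall_ne h0 h.2.1))
  have hev : riemannZeta =ᶠ[𝓝 ρ] riemannXi * u := by
    filter_upwards [hopen.mem_nhds hmem] with z hz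
    simp only [mem_compl_iff, mem_insert_iff, mem_singleton_iff, not_or] at hz
    exact riemannZeta_eq_riemannXi_mul hz.1 hz.2
  rw [zeroMultiplicity, analyticOrderNatAt, analyticOrderNatAt, analyticOrderAt_congr hev,
    analyticOrderAt_mul (differentiable_riemannXi.analyticAt ρ) hu,
    hu.analyticOrderAt_eq_zero.mpr hu0, add_zero]

lemma norm_completedRiemannZeta₀_le_of_strip {s : ℂ} (h0 : 0 ≤ s.re) (h1 : s.re ≤ 1) :
    ‖completedRiemannZeta₀ s‖ ≤ 4 / 65 :=
  (norm_completedRiemannZeta₀_le (τ := 1) (by simpa using h0) h1).trans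
    (by simpa using norm_completedRiemannZeta₀_one_le)

/-- A zero-free region around the center of the critical strip; on the critical line it says
that the zeros have ordinates of modulus at least `4`. -/
lemma norm_mul_sub_one_ge_of_mem {ρ : ℂ} (h : ρ ∈ nontrivialZeros) :
    65 / 4 ≤ ‖ρ * (ρ - 1)‖ := by
  have h1 := norm_completedRiemannZeta₀_le_of_strip (re_pos_of_mem h).le (re_lt_one_of_mem h).le
  have h2 := mem_nontrivialZeros_iff.mp h
  have h3 : ρ * (ρ - 1) * completedRiemannZeta₀ ρ = -1 := by
    rw [riemannXi] at h2
    linear_combination 2 * h2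
  have h4 := congrArg norm h3
  rw [norm_mul, norm_neg, norm_one] at h4
  nlinarith [norm_nonneg (ρ * (ρ - 1)), norm_nonneg (completedRiemannZeta₀ ρ)]

lemma riemannXi_one_half_mem_slitPlane : riemannXi (1 / 2) ∈ slitPlane := by
  have h1 := norm_completedRiemannZeta₀_le_of_strip (s := 1 / 2) (by norm_num) (by norm_num)
  have h2 := (abs_le.mp (abs_re_le_norm (completedRiemannZeta₀ (1 / 2)))).2
  left
  have : riemannXi (1 / 2) =
      ((1 / 2 : ℝ) : ℂ) - ((1 / 8 : ℝ) : ℂ) * completedRiemannZeta₀ (1 / 2) := by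
    rw [riemannXi]; push_cast; ring
  rw [this, sub_re, ofReal_re, re_ofReal_mul]
  linarith

lemma sub_half_ne_zero_of_mem {ρ : ℂ} (h : ρ ∈ nontrivialZeros) : ρ - 1 / 2 ≠ 0 := by
  intro h0
  rw [sub_eq_zero] at h0
  subst h0
  exact slitPlane_ne_zero riemannXi_one_half_mem_slitPlane (mem_nontrivialZeros_iff.mp h)

/-! ### Growth of the xi function -/

lemma factorial_le_exp {M : ℕ} (hM : 1 ≤ M) :
    ((M - 1).factorial : ℝ) ≤ Real.exp (2 * (M * √M)) := by
  have hM' : (0 : ℝ) < M := by exact_mod_cast hM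
  calc ((M - 1).factorial : ℝ) ≤ (M : ℝ) ^ M := by
        exact_mod_cast (Nat.factorial_le (Nat.sub_le M 1)).trans (Nat.factorial_le_pow M)
    _ = Real.exp (M * Real.log M) := by
        rw [mul_comm, Real.exp_mul, Real.exp_log hM', Real.rpow_natCast]
    _ ≤ Real.exp (2 * (M * √M)) := by
        apply Real.exp_le_exp.mpr
        have h1 : Real.log M ≤ 2 * √M := by
          have h := Real.log_le_sub_one_of_pos (Real.sqrt_pos.mpr hM')
          rw [Real.log_sqrt hM'.le] at h
          linarith
        nlinarith

lemma norm_completedRiemannZeta_two_mul_le {M : ℕ} (hM : 1 ≤ M) :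
    ‖completedRiemannZeta (2 * M : ℂ)‖ ≤
      Real.exp (2 * (M * √M)) * ∑' n : ℕ, 1 / (n : ℝ) ^ 2 := by
  have hM' : (1 : ℝ) ≤ M := by exact_mod_cast hM
  have hre : (2 * M : ℂ).re = 2 * M := by simp
  rw [completedZeta_eq_tsum_of_one_lt_re (by rw [hre]; linarith), norm_mul, norm_mul]
  have h1 : ‖(Real.pi : ℂ) ^ (-(2 * M : ℂ) / 2)‖ ≤ 1 := by
    rw [norm_cpow_eq_rpow_re_of_pos Real.pi_pos]
    apply Real.rpow_le_one_of_one_le_of_nonpos (by linarith [Real.pi_gt_three])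
    rw [neg_div, mul_div_cancel_left₀ _ (two_ne_zero)]
    simp
  have h2 : ‖Gamma ((2 * M : ℂ) / 2)‖ ≤ Real.exp (2 * (M * √M)) := by
    rw [mul_div_cancel_left₀ _ (two_ne_zero)]
    obtain ⟨k, rfl⟩ : ∃ k, M = k + 1 := ⟨M - 1, by omega⟩
    have := factorial_le_exp hM
    push_cast at this ⊢
    rw [Complex.Gamma_nat_eq_factorial]
    simpa using this
  have hs : Summable fun n : ℕ => 1 / (n : ℝ) ^ 2 := Real.summable_one_div_nat_pow.mpr (by norm_num)
  have h3 : ‖∑' n : ℕ, 1 / (n : ℂ) ^ (2 * M : ℂ)‖ ≤ ∑' n : ℕ, 1 / (n : ℝ) ^ 2 := by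
    refine tsum_of_norm_bounded hs.hasSum fun n => ?_
    rcases Nat.eq_zero_or_pos n with rfl | hn
    · have : (2 * M : ℂ) ≠ 0 := by
        have : (M : ℂ) ≠ 0 := by exact_mod_cast (by omega : M ≠ 0)
        simpa using this
      simp [zero_cpow this]
    · have hn' : (1 : ℝ) ≤ n := by exact_mod_cast hn
      have : (2 * M : ℂ) = ((2 * M : ℕ) : ℂ) := by push_cast; rfl
      rw [this, cpow_natCast, norm_div, norm_one, norm_pow, norm_natCast]
      gcongr
      omega
  calc _ ≤ 1 * Real.exp (2 * (M * √M)) * ∑' n : ℕ, 1 / (n : ℝ) ^ 2 := by gcongr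
    _ = _ := by ring

/-- The function `ξ` has order less than two (its true order is one). -/
lemma exists_norm_riemannXi_le : ∃ C : ℝ, 0 < C ∧ ∀ R : ℝ, 1 ≤ R → ∀ z : ℂ, ‖z - 1 / 2‖ ≤ R →
    ‖riemannXi z‖ ≤ Real.exp (C * (R * √R)) := by
  set c : ℝ := ∑' n : ℕ, 1 / (n : ℝ) ^ 2 with hc
  have hc0 : 0 ≤ c := tsum_nonneg fun n => by positivity
  refine ⟨2 * c + 19, by positivity, fun R hR z hz => ?_⟩
  have hsR : 1 ≤ √R := Real.one_le_sqrt.mpr hR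
  set X := R * √R with hX
  have hRX : R ≤ X := by nlinarith
  -- an even integer beyond the real parts in question
  obtain ⟨M, hM1, hM2⟩ : ∃ M : ℕ, R + 1 ≤ M ∧ (M : ℝ) ≤ 3 * R :=
    ⟨⌈R⌉₊ + 1, by push_cast; linarith [Nat.le_ceil R],
      by push_cast; linarith [Nat.ceil_lt_add_one (by linarith : 0 ≤ R)]⟩
  have hM : 1 ≤ M := by
    have : (1 : ℝ) ≤ M := by linarith
    exact_mod_cast this
  have hzre := (abs_le.mp ((abs_re_le_norm (z - 1 / 2)).trans hz))
  simp only [sub_re] at hzre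
  norm_num at hzre
  have hMX : 2 * (M * √M) ≤ 12 * X := by
    have h3 : √M ≤ 2 * √R := by
      have : √(M : ℝ) ≤ √(2 ^ 2 * R) := Real.sqrt_le_sqrt (by linarith)
      rwa [Real.sqrt_mul (by norm_num), Real.sqrt_sq (by norm_num)] at this
    have : (M : ℝ) * √M ≤ 3 * R * (2 * √R) := by gcongr
    linarith
  have hΛ : ‖completedRiemannZeta₀ z‖ ≤ Real.exp (12 * X) * c + 2 := by
    have h1 := norm_completedRiemannZeta₀_le (s := z) (τ := 2 * M) (by linarith) (by linarith)
    refine h1.trans ?_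
    push_cast
    have h2 := completedRiemannZeta_eq (2 * M : ℂ)
    have h3 : completedRiemannZeta₀ (2 * M : ℂ) =
        completedRiemannZeta (2 * M : ℂ) + 1 / (2 * M : ℂ) + 1 / (1 - 2 * M : ℂ) := by
      rw [h2]; ring
    rw [h3]
    have h4 : ‖1 / (2 * M : ℂ)‖ ≤ 1 := by
      rw [norm_div, norm_one, div_le_one]
      · simp; linarith
      · simp; linarith
    have h5 : ‖1 / (1 - 2 * M : ℂ)‖ ≤ 1 := by
      have : ‖(1 - 2 * M : ℂ)‖ = 2 * M - 1 := by
        rw [norm_sub_rev, show (2 * M - 1 : ℂ) = ((2 * M - 1 : ℝ) : ℂ) by push_cast; rfl, norm_real,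
          Real.norm_of_nonneg (by linarith)]
      rw [norm_div, norm_one, this, div_le_one (by linarith)]
      linarith
    have h6 : ‖completedRiemannZeta (2 * M : ℂ)‖ ≤ Real.exp (12 * X) * c :=
      (norm_completedRiemannZeta_two_mul_le hM).trans (by gcongr)
    calc _ ≤ _ := norm_add₃_le
      _ ≤ _ := by linarith
  have hz0 : ‖z‖ ≤ 2 * R := by
    calc ‖z‖ = ‖(z - 1 / 2) + 1 / 2‖ := by ring_nf
      _ ≤ ‖z - 1 / 2‖ + ‖(1 / 2 : ℂ)‖ := norm_add_le _ _
      _ ≤ 2 * R := by norm_num; linarith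
  have hz1 : ‖z - 1‖ ≤ 2 * R := by
    calc ‖z - 1‖ = ‖(z - 1 / 2) - 1 / 2‖ := by ring_nf
      _ ≤ ‖z - 1 / 2‖ + ‖(1 / 2 : ℂ)‖ := norm_sub_le _ _
      _ ≤ 2 * R := by norm_num; linarith
  have hXe : X ≤ Real.exp X := by linarith [Real.add_one_le_exp X]
  have hR2 : R ^ 2 ≤ Real.exp (2 * X) := by
    rw [two_mul, Real.exp_add, sq]
    have : R ≤ Real.exp X := hRX.trans hXe
    gcongr
  have he1 : 1 ≤ Real.exp (12 * X) := Real.one_le_exp (by linarith)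
  have he2 : 1 ≤ Real.exp (14 * X) := Real.one_le_exp (by linarith)
  calc ‖riemannXi z‖ ≤ 1 / 2 * (2 * R * (2 * R) * (Real.exp (12 * X) * c + 2) + 1) := by
        rw [riemannXi, norm_mul]
        have : ‖(1 / 2 : ℂ)‖ = 1 / 2 := by norm_num
        rw [this]
        gcongr
        refine (norm_add_le _ _).trans ?_
        rw [norm_mul, norm_mul, norm_one]
        gcongr
    _ ≤ 1 / 2 * (4 * Real.exp (2 * X) * (Real.exp (12 * X) * (c + 2)) + Real.exp (14 * X)) := by
        have : Real.exp (12 * X) * c + 2 ≤ Real.exp (12 * X) * (c + 2) := by nlinarith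
        have h' : 2 * R * (2 * R) ≤ 4 * Real.exp (2 * X) := by nlinarith
        gcongr
    _ = (2 * c + 9 / 2) * Real.exp (14 * X) := by
        rw [show 14 * X = 2 * X + 12 * X by ring, Real.exp_add]; ring
    _ ≤ Real.exp ((2 * c + 5) * X) * Real.exp (14 * X) := by
        gcongr
        have := Real.add_one_le_exp ((2 * c + 5) * X)
        nlinarith
    _ = Real.exp ((2 * c + 19) * X) := by rw [← Real.exp_add]; ring_nf

/-! ### Dividing an entire function by its zeros in a disc -/

section EntireFunctions

variable {f : ℂ → ℂ} {c : ℂ}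

lemma analyticOrderAt_ne_top_of_differentiable (hf : Differentiable ℂ f) (hc : f c ≠ 0) (z : ℂ) :
    analyticOrderAt f z ≠ ⊤ := by
  intro h
  rw [analyticOrderAt_eq_top] at h
  have ha : AnalyticOnNhd ℂ f univ := fun x _ => hf.analyticAt x
  exact hc (ha.eqOn_zero_of_preconnected_of_eventuallyEq_zero isPreconnected_univ (mem_univ z) h
    (mem_univ c))

lemma finite_zeros_closedBall (hf : Differentiable ℂ f) (hc : f c ≠ 0) (R : ℝ) :
    {z | f z = 0 ∧ ‖z - c‖ ≤ R}.Finite := by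
  have ha : AnalyticOnNhd ℂ f univ := fun x _ => hf.analyticAt x
  have hcod : f ⁻¹' {0}ᶜ ∈ codiscrete ℂ := ha.preimage_zero_mem_codiscrete hc
  have hcod' : {z | f z = 0}ᶜ ∈ codiscrete ℂ := hcod
  obtain ⟨h1, h2⟩ := mem_codiscrete'.mp hcod'
  rw [compl_compl] at h2
  have h := ((isCompact_closedBall c R).inter_right (isOpen_compl_iff.mp h1)).finite
    (h2.mono inter_subset_right)
  refine h.subset fun z hz => ⟨?_, hz.1⟩
  simpa [dist_eq_norm] using hz.2

open Classical in
/-- The finite set of zeros of an entire function in a closed disc (empty, by convention, if there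
are infinitely many). -/
def zerosInDisc (f : ℂ → ℂ) (c : ℂ) (R : ℝ) : Finset ℂ :=
  if h : {z | f z = 0 ∧ ‖z - c‖ ≤ R}.Finite then h.toFinset else ∅

lemma mem_zerosInDisc (hf : Differentiable ℂ f) (hc : f c ≠ 0) {R : ℝ} {z : ℂ} :
    z ∈ zerosInDisc f c R ↔ f z = 0 ∧ ‖z - c‖ ≤ R := by
  simp [zerosInDisc, finite_zeros_closedBall hf hc R]

/-- An entire function is divisible by the full power of `z - ρ` given by its order at `ρ`. -/
lemma exists_eq_pow_order_mul (hf : Differentiable ℂ f) {ρ : ℂ} (hρ : analyticOrderAt f ρ ≠ ⊤) :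
    ∃ h : ℂ → ℂ, Differentiable ℂ h ∧
      (∀ z, f z = (z - ρ) ^ analyticOrderNatAt f ρ * h z) ∧ h ρ ≠ 0 := by
  obtain ⟨p, hp⟩ := hf.analyticAt ρ
  have hp0 : p ≠ 0 := by
    intro h0
    exact hρ (analyticOrderAt_eq_top.mpr (hp.locally_zero_iff.mpr h0))
  have hdiff : ∀ n : ℕ, Differentiable ℂ ((Function.swap dslope ρ)^[n] f) := by
    intro n
    induction n with
    | zero => simpa using hf
    | succ n ih =>
      rw [Function.iterate_succ_apply']
      rw [← differentiableOn_univ] at ih ⊢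
      exact (Complex.differentiableOn_dslope univ_mem).mpr ih
  set h := (Function.swap dslope ρ)^[p.order] f with hh
  have hne : h ρ ≠ 0 := hp.iterate_dslope_fslope_ne_zero hp0
  have heq : ∀ z, f z = (z - ρ) ^ p.order • h z := hp.eq_pow_order_mul_iterate_dslope
  have hord : analyticOrderNatAt f ρ = p.order :=
    ((hf.analyticAt ρ).analyticOrderNatAt_eq_iff hρ).mpr
      ⟨h, (hdiff _).analyticAt ρ, hne, .of_forall heq⟩
  exact ⟨h, hdiff _, fun z => by rw [hord]; simpa using heq z, hne⟩

/-- The polynomial with value `1` at `c` whose zeros are the points of `S`, with the multiplicities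
they have as zeros of `f`. -/
def zeroProduct (f : ℂ → ℂ) (c : ℂ) (S : Finset ℂ) (z : ℂ) : ℂ :=
  ∏ ρ ∈ S, (1 - (z - c) / (ρ - c)) ^ analyticOrderNatAt f ρ

lemma zeroProduct_center (S : Finset ℂ) : zeroProduct f c S c = 1 := by
  simp [zeroProduct]

lemma differentiable_zeroProduct (S : Finset ℂ) : Differentiable ℂ (zeroProduct f c S) := by
  unfold zeroProduct
  fun_prop

lemma one_sub_div_ne_zero {z ρ : ℂ} (hρ : ρ ≠ c) (h : z ≠ ρ) : 1 - (z - c) / (ρ - c) ≠ 0 := by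
  have h1 := sub_ne_zero.mpr hρ
  have : 1 - (z - c) / (ρ - c) = (ρ - z) / (ρ - c) := by field_simp; ring
  rw [this]
  exact div_ne_zero (sub_ne_zero.mpr h.symm) h1

lemma zeroProduct_ne_zero {S : Finset ℂ} (hS : c ∉ S) {z : ℂ} (hz : z ∉ S) :
    zeroProduct f c S z ≠ 0 :=
  Finset.prod_ne_zero_iff.mpr fun _ hρ => pow_ne_zero _ <|
    one_sub_div_ne_zero (fun h => hS (h ▸ hρ)) (fun h => hz (h ▸ hρ))

/-- Dividing out finitely many zeros. -/
lemma exists_eq_zeroProduct_mul (hf : Differentiable ℂ f) (hc : f c ≠ 0) (S : Finset ℂ)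
    (hS : c ∉ S) :
    ∃ h : ℂ → ℂ, Differentiable ℂ h ∧ (∀ z, f z = zeroProduct f c S z * h z) ∧
      ∀ ρ ∈ S, h ρ ≠ 0 := by
  classical
  induction S using Finset.induction_on with
  | empty => exact ⟨f, hf, fun z => by simp [zeroProduct], by simp⟩
  | insert ρ S hρ ih =>
    have hS' : c ∉ S := fun h => hS (Finset.mem_insert_of_mem h)
    have hρc : ρ ≠ c := fun h => hS (h ▸ Finset.mem_insert_self _ _)
    obtain ⟨h, hd, heq, hne⟩ := ih hS'
    have hord : analyticOrderAt f ρ = analyticOrderAt h ρ := by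
      have h1 : f = zeroProduct f c S * h := funext heq
      conv_lhs => rw [h1]
      have ha := (differentiable_zeroProduct (f := f) (c := c) S).analyticAt ρ
      rw [analyticOrderAt_mul ha (hd.analyticAt ρ),
        ha.analyticOrderAt_eq_zero.mpr (zeroProduct_ne_zero hS' hρ), zero_add]
    obtain ⟨k, hkd, hkeq, hkne⟩ := exists_eq_pow_order_mul hd
      (hord ▸ analyticOrderAt_ne_top_of_differentiable hf hc ρ)
    have hordN : analyticOrderNatAt h ρ = analyticOrderNatAt f ρ := by
      rw [analyticOrderNatAt, analyticOrderNatAt, hord]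
    rw [hordN] at hkeq
    set m := analyticOrderNatAt f ρ with hm
    have hcρ : c - ρ ≠ 0 := sub_ne_zero.mpr hρc.symm
    refine ⟨fun z => (c - ρ) ^ m * k z, by fun_prop, fun z => ?_, ?_⟩
    · have h1 : (1 - (z - c) / (ρ - c)) * (c - ρ) = z - ρ := by
        have : ρ - c ≠ 0 := sub_ne_zero.mpr hρc
        field_simp
        ring
      rw [heq z, hkeq z, zeroProduct, zeroProduct, Finset.prod_insert hρ, ← hm, ← h1, mul_pow]
      ring
    · intro σ hσ
      refine mul_ne_zero (pow_ne_zero _ hcρ) ?_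
      rcases Finset.mem_insert.mp hσ with rfl | hσ
      · exact hkne
      · have := hne σ hσ
        rw [hkeq] at this
        exact right_ne_zero_of_mul this

/-- After division by the zeros in a disc of radius `R`, the maximum principle on the disc of
radius `3R`, on whose boundary every factor has modulus at least `2`, gives a gain of `2` for each
zero. -/
lemma norm_quotient_mul_le (hf : Differentiable ℂ f) (hc : f c ≠ 0) {R M : ℝ} (hR : 0 < R)
    (hM : ∀ z, ‖z - c‖ ≤ 3 * R → ‖f z‖ ≤ M) {h : ℂ → ℂ} (hd : Differentiable ℂ h)
    (heq : ∀ z, f z = zeroProduct f c (zerosInDisc f c R) z * h z) {z : ℂ} (hz : ‖z - c‖ ≤ 3 * R) :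
    ‖h z‖ * 2 ^ (∑ ρ ∈ zerosInDisc f c R, analyticOrderNatAt f ρ) ≤ M := by
  set S := zerosInDisc f c R with hS
  set N := ∑ ρ ∈ S, analyticOrderNatAt f ρ with hN
  rw [← le_div_iff₀ (by positivity)]
  have hR3 : 3 * R ≠ 0 := by positivity
  refine Complex.norm_le_of_forall_mem_frontier_norm_le (U := Metric.ball c (3 * R))
    Metric.isBounded_ball hd.diffContOnCl (fun y hy => ?_) ?_
  · rw [frontier_ball c hR3, mem_sphere_iff_norm] at hy
    rw [le_div_iff₀ (by positivity)]
    refine le_trans ?_ (hM y hy.le)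
    rw [heq y, norm_mul, mul_comm]
    gcongr
    rw [zeroProduct, norm_prod, hN, ← Finset.prod_pow_eq_pow_sum]
    refine Finset.prod_le_prod (fun _ _ => by positivity) fun ρ hρ => ?_
    rw [norm_pow]
    gcongr
    obtain ⟨h0, hρR⟩ := (mem_zerosInDisc hf hc).mp hρ
    have hρc : ρ ≠ c := by rintro rfl; exact hc h0
    have hpos : 0 < ‖ρ - c‖ := norm_pos_iff.mpr (sub_ne_zero.mpr hρc)
    have h3 : 3 ≤ ‖(y - c) / (ρ - c)‖ := by
      rw [norm_div, hy, le_div_iff₀ hpos]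
      linarith
    have h4 := norm_sub_norm_le ((y - c) / (ρ - c)) 1
    rw [norm_sub_rev, norm_one] at h4
    linarith
  · rw [closure_ball c hR3, mem_closedBall_iff_norm]
    exact hz

/-- **Jensen's inequality** for the number of zeros in a disc. -/
lemma norm_mul_two_pow_le (hf : Differentiable ℂ f) (hc : f c ≠ 0) {R M : ℝ} (hR : 0 < R)
    (hM : ∀ z, ‖z - c‖ ≤ 3 * R → ‖f z‖ ≤ M) :
    ‖f c‖ * 2 ^ (∑ ρ ∈ zerosInDisc f c R, analyticOrderNatAt f ρ) ≤ M := by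
  have hcS : c ∉ zerosInDisc f c R := fun h => hc ((mem_zerosInDisc hf hc).mp h).1
  obtain ⟨h, hd, heq, -⟩ := exists_eq_zeroProduct_mul hf hc _ hcS
  have h1 : f c = h c := by rw [heq c, zeroProduct_center, one_mul]
  rw [h1]
  exact norm_quotient_mul_le hf hc hR hM hd heq (by simp; positivity)

/-- A holomorphic function on a disc without zeros has a logarithm there; the Borel–Carathéodory
theorem and Cauchy's estimates bound the derivatives of its logarithmic derivative. -/
lemma norm_iteratedDeriv_logDeriv_le {h : ℂ → ℂ} (hd : Differentiable ℂ h) {R A : ℝ} (hR : 0 < R)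
    (hA : 0 < A) (hne : ∀ z ∈ Metric.ball c R, h z ≠ 0)
    (hle : ∀ z ∈ Metric.ball c R, ‖h z‖ ≤ ‖h c‖ * Real.exp A) (k : ℕ) :
    ‖iteratedDeriv k (logDeriv h) c‖ ≤ (k + 1).factorial * (2 * A) / (R / 2) ^ (k + 1) := by
  have hdiff : DifferentiableOn ℂ (logDeriv h) (Metric.ball c R) := fun z hz =>
    ((hd.analyticAt z).deriv.differentiableAt.div (hd z) (hne z hz)).differentiableWithinAt
  obtain ⟨g, hgc, hg⟩ := hdiff.isExactOn_ball.with_val_at c 0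
  have hcm : c ∈ Metric.ball c R := Metric.mem_ball_self hR
  have hexp : ∀ z ∈ Metric.ball c R, h z * exp (-g z) = h c := by
    intro z hz
    have hder : ∀ x ∈ Metric.ball c R, HasDerivAt (fun x => h x * exp (-g x)) 0 x := by
      intro x hx
      have h1 := (hd x).hasDerivAt.mul ((hg x hx).neg.cexp)
      have h0 : deriv h x * cexp ((-g) x) + h x * (cexp ((-g) x) * -logDeriv h x) = 0 := by
        rw [logDeriv_apply]
        field_simp [hne x hx]
        ring
      rw [h0] at h1
      exact h1
    have := (convex_ball c R).is_const_of_fderivWithin_eq_zero (𝕜 := ℂ)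
      (f := fun x => h x * exp (-g x))
      (fun x hx => (hder x hx).differentiableAt.differentiableWithinAt)
      (fun x hx => by
        rw [fderivWithin_of_isOpen Metric.isOpen_ball hx]
        ext
        simp [(hder x hx).deriv]) hz hcm
    simpa [hgc] using this
  have hre : ∀ z ∈ Metric.ball c R, (g z).re ≤ A := by
    intro z hz
    have h1 := congrArg norm (hexp z hz)
    rw [norm_mul, norm_exp, neg_re] at h1
    have h2 := hle z hz
    rw [← h1] at h2
    have h3 : 0 < ‖h z‖ := norm_pos_iff.mpr (hne z hz)
    rw [mul_assoc, ← Real.exp_add] at h2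
    have h4 : Real.exp 0 ≤ Real.exp (-(g z).re + A) := by
      rw [Real.exp_zero]
      by_contra! hlt
      nlinarith
    have := Real.exp_le_exp.mp h4
    linarith
  have hbound : ∀ z ∈ Metric.sphere c (R / 2), ‖g z‖ ≤ 2 * A := by
    intro z hz
    rw [mem_sphere_iff_norm] at hz
    have hmaps : ∀ x ∈ Metric.ball (0 : ℂ) R, c + x ∈ Metric.ball c R := by
      intro x hx
      simpa [mem_ball_iff_norm] using hx
    have := borelCaratheodory_zero (f := fun x => g (c + x)) (z := z - c) (R := R) hA
      (fun x hx => by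
        have := (hg (c + x) (hmaps x hx)).differentiableAt
        exact (this.comp x (by fun_prop)).differentiableWithinAt)
      (fun x hx => hre _ (hmaps x hx)) hR (by rw [mem_ball_zero_iff, hz]; linarith)
      (by simpa using hgc)
    rw [hz] at this
    simp only [add_sub_cancel] at this
    refine this.trans (le_of_eq ?_)
    field_simp
    ring
  have hev : logDeriv h =ᶠ[𝓝 c] deriv g := by
    filter_upwards [Metric.isOpen_ball.mem_nhds hcm] with z hz
    exact (hg z hz).deriv.symm
  rw [hev.iteratedDeriv_eq, ← iteratedDeriv_succ']
  refine norm_iteratedDeriv_le_of_forall_mem_sphere_norm_le (k + 1) (by positivity) ?_ hbound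
  refine DifferentiableOn.diffContOnCl fun z hz => ?_
  rw [closure_ball c (by positivity)] at hz
  have hz' := Metric.closedBall_subset_ball (by linarith : R / 2 < R) hz
  exact (hg z hz').differentiableAt.differentiableWithinAt

/-- The Taylor coefficients at `c` of the logarithmic derivative of a zero product. -/
lemma iteratedDeriv_logDeriv_zeroProduct {S : Finset ℂ} (hS : c ∉ S) (k : ℕ) :
    iteratedDeriv k (logDeriv (zeroProduct f c S)) c =
      -(k.factorial * ∑ ρ ∈ S, (analyticOrderNatAt f ρ : ℂ) * ((ρ - c) ^ (k + 1))⁻¹) := by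
  have hev : logDeriv (zeroProduct f c S) =ᶠ[𝓝 c]
      fun z => ∑ ρ ∈ S, (analyticOrderNatAt f ρ : ℂ) * (z - ρ)⁻¹ := by
    have hopen : IsOpen ((S : Set ℂ)ᶜ) := S.finite_toSet.isClosed.isOpen_compl
    filter_upwards [hopen.mem_nhds (by simpa using hS)] with z hz
    have hz' : z ∉ S := by simpa using hz
    have h1 : ∀ ρ ∈ S, ρ ≠ c := fun ρ hρ h => hS (h ▸ hρ)
    have h2 : ∀ ρ ∈ S, z ≠ ρ := fun ρ hρ h => hz' (h ▸ hρ)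
    unfold zeroProduct
    rw [logDeriv_prod (f := fun ρ z => (1 - (z - c) / (ρ - c)) ^ analyticOrderNatAt f ρ)
      (fun ρ hρ => pow_ne_zero _ (one_sub_div_ne_zero (h1 ρ hρ) (h2 ρ hρ)))
      (fun ρ _ => by fun_prop)]
    refine Finset.sum_congr rfl fun ρ hρ => ?_
    rw [logDeriv_fun_pow (f := fun z => 1 - (z - c) / (ρ - c)) (by fun_prop), logDeriv_apply]
    have hder : deriv (fun z => 1 - (z - c) / (ρ - c)) z = -(1 / (ρ - c)) := by
      have : HasDerivAt (fun z => 1 - (z - c) / (ρ - c)) (-(1 / (ρ - c))) z :=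
        (((hasDerivAt_id z).sub_const c).div_const (ρ - c)).const_sub 1
      exact this.deriv
    rw [hder]
    have e1 : ρ - c ≠ 0 := sub_ne_zero.mpr (h1 ρ hρ)
    have e2 : z - ρ ≠ 0 := sub_ne_zero.mpr (h2 ρ hρ)
    have e3 : 1 - (z - c) / (ρ - c) = -((z - ρ) / (ρ - c)) := by field_simp; ring
    rw [e3]
    field_simp
  have hne : ∀ ρ ∈ S, c - ρ ≠ 0 := fun ρ hρ => sub_ne_zero.mpr fun h => hS (h ▸ hρ)
  have hcd : ∀ ρ ∈ S, ContDiffAt ℂ k (fun z => (z - ρ)⁻¹) c := fun ρ hρ =>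
    (contDiffAt_id.sub contDiffAt_const).inv (hne ρ hρ)
  rw [hev.iteratedDeriv_eq, iteratedDeriv_fun_sum fun ρ hρ => contDiffAt_const.mul (hcd ρ hρ),
    Finset.mul_sum, ← Finset.sum_neg_distrib]
  refine Finset.sum_congr rfl fun ρ hρ => ?_
  have h1 : iteratedDeriv k (fun z : ℂ => (z - ρ)⁻¹) c =
      (-1) ^ k * k.factorial * (c - ρ) ^ (-1 - k : ℤ) := by
    have := congrFun (iteratedDeriv_comp_sub_const k (fun z : ℂ => z⁻¹) ρ) c
    rw [this, iteratedDeriv_eq_iterate, iter_deriv_inv]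
  rw [iteratedDeriv_const_mul _ (hcd ρ hρ), h1]
  have h2 : (c - ρ) ^ (-1 - k : ℤ) = ((c - ρ) ^ (k + 1))⁻¹ := by
    rw [← zpow_natCast, ← zpow_neg]; congr 1; push_cast; ring
  have h3 : (c - ρ) ^ (k + 1) = (-1) ^ (k + 1) * (ρ - c) ^ (k + 1) := by rw [← mul_pow]; ring
  have h4 : ((-1 : ℂ) ^ (k + 1))⁻¹ = (-1) ^ (k + 1) := by
    rw [← inv_pow]; norm_num
  have h5 : (-1 : ℂ) ^ k * (-1) ^ k = 1 := by rw [← mul_pow]; norm_num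
  rw [h2, h3, mul_inv, h4, pow_succ (-1 : ℂ)]
  linear_combination (-(analyticOrderNatAt f ρ : ℂ) * k.factorial * ((ρ - c) ^ (k + 1))⁻¹) * h5

/-- Approximate form, on a disc of radius `R`, of the expansion of the logarithmic derivative over
zeros. -/
lemma norm_iteratedDeriv_logDeriv_add_sum_le (hf : Differentiable ℂ f) (hc : f c ≠ 0) {R A : ℝ}
    (hR : 0 < R) (hA : 0 < A) (hM : ∀ z, ‖z - c‖ ≤ 3 * R → ‖f z‖ ≤ ‖f c‖ * Real.exp A) (k : ℕ) :
    ‖iteratedDeriv k (logDeriv f) c + k.factorial * ∑ ρ ∈ zerosInDisc f c R,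
      (analyticOrderNatAt f ρ : ℂ) * ((ρ - c) ^ (k + 1))⁻¹‖ ≤
      (k + 1).factorial * (2 * A) / (R / 2) ^ (k + 1) := by
  set S := zerosInDisc f c R with hS
  have hcS : c ∉ S := fun h => hc ((mem_zerosInDisc hf hc).mp h).1
  obtain ⟨h, hd, heq, hne⟩ := exists_eq_zeroProduct_mul hf hc S hcS
  have h1 : f c = h c := by rw [heq c, zeroProduct_center, one_mul]
  have hlog : iteratedDeriv k (logDeriv f) c =
      iteratedDeriv k (logDeriv (zeroProduct f c S)) c + iteratedDeriv k (logDeriv h) c := by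
    have hP := differentiable_zeroProduct (f := f) (c := c) S
    have hPc : zeroProduct f c S c ≠ 0 := zeroProduct_ne_zero hcS hcS
    have hhc : h c ≠ 0 := h1 ▸ hc
    have hev : logDeriv f =ᶠ[𝓝 c] fun z => logDeriv (zeroProduct f c S) z + logDeriv h z := by
      filter_upwards [hP.continuous.continuousAt.eventually_ne hPc,
        hd.continuous.continuousAt.eventually_ne hhc] with z e1 e2
      have : f = fun z => zeroProduct f c S z * h z := funext heq
      conv_lhs => rw [this]
      exact logDeriv_mul z e1 e2 (hP z) (hd z)
    have hcd : ∀ {u : ℂ → ℂ}, Differentiable ℂ u → u c ≠ 0 → ContDiffAt ℂ k (logDeriv u) c :=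
      fun {u} hu hu0 => ((hu.analyticAt c).deriv.div (hu.analyticAt c) hu0).contDiffAt
    rw [hev.iteratedDeriv_eq, iteratedDeriv_fun_add (hcd hP hPc) (hcd hd hhc)]
  rw [hlog, iteratedDeriv_logDeriv_zeroProduct hcS, neg_add_cancel_comm]
  refine norm_iteratedDeriv_logDeriv_le hd hR hA (fun z hz h0 => ?_) (fun z hz => ?_) k
  · rw [mem_ball_iff_norm] at hz
    exact hne z ((mem_zerosInDisc hf hc).mpr ⟨by rw [heq z, h0, mul_zero], hz.le⟩) h0
  · rw [mem_ball_iff_norm] at hz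
    rw [← h1]
    refine le_trans ?_ (norm_quotient_mul_le hf hc hR hM hd heq (by linarith : ‖z - c‖ ≤ 3 * R))
    exact le_mul_of_one_le_right (norm_nonneg _) (one_le_pow₀ (by norm_num))

end EntireFunctions

/-! ### Sums over the zeros of an entire function of order less than two -/

section OrderLessThanTwo

variable {f : ℂ → ℂ} {c : ℂ}

/-- A growth bound by `exp (C R^(3/2))`, restated for use on the disc of radius `3R` and relative
to the value at the center. -/
lemma exists_norm_le_norm_mul_exp (hc : f c ≠ 0) {C : ℝ} (hC : 0 < C)
    (hgrowth : ∀ R : ℝ, 1 ≤ R → ∀ z : ℂ, ‖z - c‖ ≤ R → ‖f z‖ ≤ Real.exp (C * (R * √R))) :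
    ∃ K : ℝ, 0 < K ∧ ∀ R : ℝ, 1 ≤ R → ∀ z : ℂ, ‖z - c‖ ≤ 3 * R →
      ‖f z‖ ≤ ‖f c‖ * Real.exp (K * (R * √R)) := by
  refine ⟨6 * C + |Real.log ‖f c‖|, by positivity, fun R hR z hz => ?_⟩
  have hpos : 0 < ‖f c‖ := norm_pos_iff.mpr hc
  have h1 := hgrowth (3 * R) (by linarith) z hz
  have hsR : 1 ≤ √R := Real.one_le_sqrt.mpr hR
  have hX : 1 ≤ R * √R := by nlinarith
  have h2 : √(3 * R) ≤ 2 * √R := by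
    have : √(3 * R) ≤ √(2 ^ 2 * R) := Real.sqrt_le_sqrt (by linarith)
    rwa [Real.sqrt_mul (x := 2 ^ 2) (by norm_num), Real.sqrt_sq (by norm_num)] at this
  have h3 : 3 * R * √(3 * R) ≤ 6 * (R * √R) := by
    have : 3 * R * √(3 * R) ≤ 3 * R * (2 * √R) := by gcongr
    linarith
  refine h1.trans ?_
  have h0 : ‖f c‖ = Real.exp (Real.log ‖f c‖) := (Real.exp_log hpos).symm
  set L := Real.log ‖f c‖
  rw [h0, ← Real.exp_add]
  apply Real.exp_le_exp.mpr
  have h4 := neg_abs_le (Real.log ‖f c‖)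
  have h5 : |Real.log ‖f c‖| ≤ |Real.log ‖f c‖| * (R * √R) :=
    le_mul_of_one_le_right (abs_nonneg _) hX
  have h6 : C * (3 * R * √(3 * R)) ≤ C * (6 * (R * √R)) := by gcongr
  nlinarith

lemma sum_order_le (hf : Differentiable ℂ f) (hc : f c ≠ 0) {K : ℝ}
    (hK : ∀ R : ℝ, 1 ≤ R → ∀ z : ℂ, ‖z - c‖ ≤ 3 * R →
      ‖f z‖ ≤ ‖f c‖ * Real.exp (K * (R * √R))) {R : ℝ} (hR : 1 ≤ R) :
    ((∑ ρ ∈ zerosInDisc f c R, analyticOrderNatAt f ρ : ℕ) : ℝ) ≤ 2 * K * (R * √R) := by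
  have h := norm_mul_two_pow_le hf hc (by linarith) (hK R hR)
  set N := ∑ ρ ∈ zerosInDisc f c R, analyticOrderNatAt f ρ
  have h1 := le_of_mul_le_mul_left h (norm_pos_iff.mpr hc)
  have h2 := Real.log_le_log (by positivity) h1
  rw [Real.log_exp, Real.log_pow] at h2
  have h3 := Real.log_two_gt_d9
  have h4 : (0 : ℝ) ≤ N := N.cast_nonneg
  nlinarith

lemma exists_le_norm_sub_of_zero (hf : Differentiable ℂ f) (hc : f c ≠ 0) :
    ∃ δ : ℝ, 0 < δ ∧ ∀ z, f z = 0 → δ ≤ ‖z - c‖ := by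
  obtain ⟨δ, hδ, h⟩ := Metric.eventually_nhds_iff.mp (hf.continuous.continuousAt.eventually_ne hc)
  refine ⟨δ, hδ, fun z hz => ?_⟩
  by_contra! hlt
  exact h (by rwa [dist_eq_norm]) hz

/-- Over the shells `4^(k-1) < |ρ - c| ≤ 4^k`, the zero count `O(8^k)` is beaten by the
size `O(16^(-k))` of the terms. -/
lemma summable_order_div_sq (hf : Differentiable ℂ f) (hc : f c ≠ 0) {C : ℝ} (hC : 0 < C)
    (hgrowth : ∀ R : ℝ, 1 ≤ R → ∀ z : ℂ, ‖z - c‖ ≤ R → ‖f z‖ ≤ Real.exp (C * (R * √R))) :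
    Summable fun ρ : {z | f z = 0} => (analyticOrderNatAt f ρ : ℝ) * (‖(ρ : ℂ) - c‖ ^ 2)⁻¹ := by
  classical
  obtain ⟨K, hK0, hK⟩ := exists_norm_le_norm_mul_exp hc hC hgrowth
  obtain ⟨δ, hδ, hδle⟩ := exists_le_norm_sub_of_zero hf hc
  set E : ℝ := 16 + (δ ^ 2)⁻¹ with hE
  have hshell : ∀ ρ : {z | f z = 0}, ∃ k : ℕ, ‖(ρ : ℂ) - c‖ ≤ 4 ^ k ∧
      (‖(ρ : ℂ) - c‖ ^ 2)⁻¹ ≤ E * (16 ^ k)⁻¹ := by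
    intro ρ
    have hx := hδle ρ ρ.2
    set x := ‖(ρ : ℂ) - c‖
    have hx0 : 0 < x := hδ.trans_le hx
    have hδi : (x ^ 2)⁻¹ ≤ (δ ^ 2)⁻¹ := by gcongr
    have hex : ∃ k : ℕ, x ≤ 4 ^ k := by
      obtain ⟨k, hk⟩ := pow_unbounded_of_one_lt x (by norm_num : (1 : ℝ) < 4)
      exact ⟨k, hk.le⟩
    refine ⟨Nat.find hex, Nat.find_spec hex, ?_⟩
    rcases hk : Nat.find hex with _ | k
    · simp only [pow_zero, inv_one, mul_one, hE]
      linarith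
    · have hlt : (4 : ℝ) ^ k < x := not_le.mp (Nat.find_min hex (by omega))
      have h1 : (x ^ 2)⁻¹ ≤ (((4 : ℝ) ^ k) ^ 2)⁻¹ := by gcongr
      have h2 : (((4 : ℝ) ^ k) ^ 2)⁻¹ = 16 * (16 ^ (k + 1))⁻¹ := by
        rw [← pow_mul, mul_comm k 2, pow_mul, pow_succ]
        norm_num
        ring
      rw [h2] at h1
      refine h1.trans ?_
      gcongr
      rw [hE]
      have : 0 < (δ ^ 2)⁻¹ := by positivity
      linarith
  choose κ hκ1 hκ2 using hshell
  have hcount : ∀ (u : Finset {z | f z = 0}) (k : ℕ),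
      ∑ ρ ∈ u with κ ρ = k, (analyticOrderNatAt f ρ : ℝ) ≤ 2 * K * 8 ^ k := by
    intro u k
    have h1 : (1 : ℝ) ≤ 4 ^ k := one_le_pow₀ (by norm_num)
    have h2 := sum_order_le hf hc hK h1
    have h3 : (4 : ℝ) ^ k * √(4 ^ k) = 8 ^ k := by
      have : (4 : ℝ) ^ k = (2 ^ k) ^ 2 := by rw [← pow_mul, mul_comm, pow_mul]; norm_num
      rw [this, Real.sqrt_sq (by positivity), ← pow_succ, ← pow_mul, mul_comm, pow_mul]
      norm_num
    rw [h3] at h2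
    refine le_trans ?_ h2
    push_cast
    refine (Finset.sum_map (Finset.filter (fun ρ => κ ρ = k) u) (Function.Embedding.subtype _)
      (fun z => (analyticOrderNatAt f z : ℝ))).symm.le.trans ?_
    refine Finset.sum_le_sum_of_subset_of_nonneg (fun z hz => ?_) fun _ _ _ => Nat.cast_nonneg _
    simp only [Finset.mem_map, Finset.mem_filter] at hz
    obtain ⟨ρ, ⟨-, rfl⟩, rfl⟩ := hz
    exact (mem_zerosInDisc hf hc).mpr ⟨ρ.2, hκ1 ρ⟩
  refine summable_of_sum_le (c := E * (2 * K * 2)) (fun _ => by positivity) fun u => ?_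
  have hE0 : 0 < E := by positivity
  calc ∑ ρ ∈ u, (analyticOrderNatAt f ρ : ℝ) * (‖(ρ : ℂ) - c‖ ^ 2)⁻¹
      ≤ ∑ ρ ∈ u, (analyticOrderNatAt f ρ : ℝ) * (E * (16 ^ κ ρ)⁻¹) := by
        gcongr with ρ _
        exact hκ2 ρ
    _ = ∑ k ∈ u.image κ, ∑ ρ ∈ u with κ ρ = k,
          (analyticOrderNatAt f ρ : ℝ) * (E * (16 ^ κ ρ)⁻¹) :=
        (Finset.sum_fiberwise_of_maps_to (fun ρ hρ => Finset.mem_image_of_mem κ hρ) _).symm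
    _ = ∑ k ∈ u.image κ, (∑ ρ ∈ u with κ ρ = k, (analyticOrderNatAt f ρ : ℝ)) *
          (E * (16 ^ k)⁻¹) := by
        refine Finset.sum_congr rfl fun k _ => ?_
        rw [Finset.sum_mul]
        refine Finset.sum_congr rfl fun ρ hρ => ?_
        rw [(Finset.mem_filter.mp hρ).2]
    _ ≤ ∑ k ∈ u.image κ, (2 * K * 8 ^ k) * (E * (16 ^ k)⁻¹) := by
        gcongr with k _
        exact hcount u k
    _ = E * (2 * K * ∑ k ∈ u.image κ, (1 / 2 : ℝ) ^ k) := by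
        rw [Finset.mul_sum, Finset.mul_sum]
        refine Finset.sum_congr rfl fun k _ => ?_
        have : (16 : ℝ) ^ k = 8 ^ k * 2 ^ k := by rw [← mul_pow]; norm_num
        rw [this, one_div, inv_pow]
        field_simp
    _ ≤ E * (2 * K * 2) := by
        gcongr
        have := (summable_geometric_two).sum_le_tsum (u.image κ) (fun _ _ => by positivity)
        rwa [tsum_geometric_two] at this

lemma summable_order_mul_inv_pow (hf : Differentiable ℂ f) (hc : f c ≠ 0) {C : ℝ} (hC : 0 < C)
    (hgrowth : ∀ R : ℝ, 1 ≤ R → ∀ z : ℂ, ‖z - c‖ ≤ R → ‖f z‖ ≤ Real.exp (C * (R * √R)))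
    {k : ℕ} (hk : 1 ≤ k) :
    Summable fun ρ : {z | f z = 0} =>
      (analyticOrderNatAt f ρ : ℂ) * (((ρ : ℂ) - c) ^ (k + 1))⁻¹ := by
  obtain ⟨δ, hδ, hδle⟩ := exists_le_norm_sub_of_zero hf hc
  refine Summable.of_norm_bounded
    ((summable_order_div_sq hf hc hC hgrowth).mul_right ((δ ^ (k - 1))⁻¹)) fun ρ => ?_
  have hx := hδle ρ ρ.2
  have hx0 : 0 < ‖(ρ : ℂ) - c‖ := hδ.trans_le hx
  have h1 : k + 1 = 2 + (k - 1) := by omega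
  rw [norm_mul, norm_natCast, norm_inv, norm_pow, h1, pow_add, mul_inv, mul_assoc]
  gcongr

/-- The Taylor coefficients at `c`, from degree one on, of the logarithmic derivative of an entire
function of order less than two are power sums over its zeros. This is the part of Hadamard's
factorization that does not involve the exponential factor. -/
theorem factorial_mul_tsum_eq (hf : Differentiable ℂ f) (hc : f c ≠ 0) {C : ℝ} (hC : 0 < C)
    (hgrowth : ∀ R : ℝ, 1 ≤ R → ∀ z : ℂ, ‖z - c‖ ≤ R → ‖f z‖ ≤ Real.exp (C * (R * √R)))
    {k : ℕ} (hk : 1 ≤ k) :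
    (k.factorial : ℂ) * ∑' ρ : {z | f z = 0},
      (analyticOrderNatAt f ρ : ℂ) * (((ρ : ℂ) - c) ^ (k + 1))⁻¹ =
      -iteratedDeriv k (logDeriv f) c := by
  classical
  obtain ⟨K, hK0, hK⟩ := exists_norm_le_norm_mul_exp hc hC hgrowth
  have hsum := (summable_order_mul_inv_pow hf hc hC hgrowth hk).hasSum
  set g : ℂ → ℂ := fun z => (analyticOrderNatAt f z : ℂ) * ((z - c) ^ (k + 1))⁻¹ with hg
  let S : ℕ → Finset {z | f z = 0} := fun n =>
    (zerosInDisc f c (n + 1 : ℝ)).subtype (fun z => f z = 0)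
  have hS : Tendsto S atTop atTop := by
    refine tendsto_atTop_finset_of_monotone (fun n m hnm z hz => ?_) fun z => ?_
    · simp only [S, Finset.mem_subtype, mem_zerosInDisc hf hc] at hz ⊢
      have : (n : ℝ) ≤ m := by exact_mod_cast hnm
      exact ⟨hz.1, by linarith⟩
    · obtain ⟨n, hn⟩ := exists_nat_ge ‖(z : ℂ) - c‖
      refine ⟨n, ?_⟩
      simp only [S, Finset.mem_subtype, mem_zerosInDisc hf hc]
      exact ⟨z.2, by linarith⟩
  have hlim : Tendsto (fun n : ℕ => ∑ ρ ∈ zerosInDisc f c (n + 1 : ℝ), g ρ) atTop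
      (𝓝 (∑' ρ : {z | f z = 0}, g ρ)) := by
    refine (hsum.comp hS).congr fun n => ?_
    exact Finset.sum_subtype_of_mem g fun z hz => ((mem_zerosInDisc hf hc).mp hz).1
  have hlim2 := (tendsto_const_nhds (x := iteratedDeriv k (logDeriv f) c)).add
    (hlim.const_mul (k.factorial : ℂ))
  have hzero : Tendsto (fun n : ℕ => iteratedDeriv k (logDeriv f) c + (k.factorial : ℂ) *
      ∑ ρ ∈ zerosInDisc f c (n + 1 : ℝ), g ρ) atTop (𝓝 0) := by
    set D : ℝ := (k + 1).factorial * (2 * K) * 2 ^ (k + 1) with hD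
    have hto : Tendsto (fun n : ℕ => D / √((n : ℝ) + 1)) atTop (𝓝 0) := by
      refine tendsto_const_nhds.div_atTop ?_
      exact Real.tendsto_sqrt_atTop.comp
        (tendsto_atTop_add_const_right _ _ tendsto_natCast_atTop_atTop)
    refine squeeze_zero_norm (fun n => ?_) hto
    have hR : (1 : ℝ) ≤ (n : ℝ) + 1 := by linarith [n.cast_nonneg (α := ℝ)]
    set R : ℝ := (n : ℝ) + 1
    have hsR : 1 ≤ √R := Real.one_le_sqrt.mpr hR
    have hss : √R * √R = R := Real.mul_self_sqrt (by linarith)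
    refine (norm_iteratedDeriv_logDeriv_add_sum_le hf hc (by linarith) (A := K * (R * √R))
      (by positivity) (hK R hR) k).trans ?_
    have hRk : R ^ 2 ≤ R ^ (k + 1) := pow_le_pow_right₀ hR (by omega)
    calc ((k + 1).factorial : ℝ) * (2 * (K * (R * √R))) / (R / 2) ^ (k + 1)
        = D * (R * √R) / R ^ (k + 1) := by rw [hD, div_pow]; field_simp
      _ ≤ D * (R * √R) / R ^ 2 := by gcongr
      _ = D / √R := by
        rw [div_eq_div_iff (by positivity) (by positivity)]
        linear_combination (D * R) * hss
  have := tendsto_nhds_unique hlim2 hzero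
  linear_combination this

end OrderLessThanTwo

/-! ### Power sums over the nontrivial zeros and the derivatives of `ln ξ` -/

lemma summable_zeroMultiplicity_div_sq :
    Summable fun ρ : nontrivialZeros =>
      (zeroMultiplicity ρ : ℝ) * (‖(ρ : ℂ) - 1 / 2‖ ^ 2)⁻¹ := by
  obtain ⟨C, hC, hgrowth⟩ := exists_norm_riemannXi_le
  have h := summable_order_div_sq differentiable_riemannXi
    (slitPlane_ne_zero riemannXi_one_half_mem_slitPlane) hC hgrowth
  refine ((Equiv.setCongr nontrivialZeros_eq).summable_iff.mpr h).congr fun ρ => ?_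
  simp [zeroMultiplicity_eq ρ.2]

lemma summable_zeroMultiplicity_mul_inv_pow {j : ℕ} (hj : 2 ≤ j) :
    Summable fun ρ : nontrivialZeros =>
      (zeroMultiplicity ρ : ℂ) * (((ρ : ℂ) - 1 / 2) ^ j)⁻¹ := by
  obtain ⟨C, hC, hgrowth⟩ := exists_norm_riemannXi_le
  obtain ⟨k, rfl⟩ : ∃ k, j = k + 1 := ⟨j - 1, by omega⟩
  have h := summable_order_mul_inv_pow differentiable_riemannXi
    (slitPlane_ne_zero riemannXi_one_half_mem_slitPlane) hC hgrowth (k := k) (by omega)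
  refine ((Equiv.setCongr nontrivialZeros_eq).summable_iff.mpr h).congr fun ρ => ?_
  simp [zeroMultiplicity_eq ρ.2]

lemma analyticAt_log_riemannXi :
    AnalyticAt ℂ (fun z : ℂ => Complex.log (riemannXi z)) (1 / 2) :=
  (differentiable_riemannXi.analyticAt _).clog riemannXi_one_half_mem_slitPlane

lemma iteratedDeriv_log_riemannXi {k : ℕ} (hk : 1 ≤ k) :
    iteratedDeriv (k + 1) (fun z : ℂ => Complex.log (riemannXi z)) (1 / 2) =
      -(k.factorial * ∑' ρ : nontrivialZeros,
        (zeroMultiplicity ρ : ℂ) * (((ρ : ℂ) - 1 / 2) ^ (k + 1))⁻¹) := by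
  obtain ⟨C, hC, hgrowth⟩ := exists_norm_riemannXi_le
  have h := factorial_mul_tsum_eq differentiable_riemannXi
    (slitPlane_ne_zero riemannXi_one_half_mem_slitPlane) hC hgrowth hk
  have hs : ∑' ρ : nontrivialZeros, (zeroMultiplicity ρ : ℂ) * (((ρ : ℂ) - 1 / 2) ^ (k + 1))⁻¹ =
      ∑' ρ : {z | riemannXi z = 0},
        (analyticOrderNatAt riemannXi ρ : ℂ) * (((ρ : ℂ) - 1 / 2) ^ (k + 1))⁻¹ := by
    rw [← (Equiv.setCongr nontrivialZeros_eq).tsum_eq]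
    refine tsum_congr fun ρ => ?_
    simp [zeroMultiplicity_eq ρ.2]
  rw [hs, h, neg_neg, iteratedDeriv_succ']
  have hev : deriv (fun z : ℂ => Complex.log (riemannXi z)) =ᶠ[𝓝 (1 / 2)] logDeriv riemannXi := by
    filter_upwards [differentiable_riemannXi.continuous.continuousAt.preimage_mem_nhds
      (isOpen_slitPlane.mem_nhds riemannXi_one_half_mem_slitPlane)] with z hz
    exact ((differentiable_riemannXi z).hasDerivAt.clog hz).deriv
  exact hev.iteratedDeriv_eq k

lemma coeffA_self (a : ℝ) (n : ℕ) : coeffA a n n = 1 := by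
  simp [coeffA]

/-- The leading coefficient `A_{n,n} = 1` cancels the constant term. -/
lemma powerTerm_eq_neg_sum (a : ℝ) (n : ℕ) {ρ : ℂ} (hρ : ρ - 1 / 2 ≠ 0) :
    powerTerm a n ρ =
      -∑ k ∈ Finset.range n, (coeffA a k n : ℂ) * ((ρ - 1 / 2) ^ (2 * (n - k)))⁻¹ := by
  rw [powerTerm, Finset.sum_range_succ, coeffA_self]
  have h1 : (ρ - 1 / 2) ^ (2 * n) ≠ 0 := pow_ne_zero _ hρ
  rw [mul_add, ofReal_one, one_mul, inv_mul_cancel₀ h1, sub_add_cancel_right, Finset.mul_sum]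
  congr 1
  refine Finset.sum_congr rfl fun k hk => ?_
  have hk' : k < n := Finset.mem_range.mp hk
  have h2 : (ρ - 1 / 2) ^ (2 * n) = (ρ - 1 / 2) ^ (2 * (n - k)) * (ρ - 1 / 2) ^ (2 * k) := by
    rw [← pow_add]; congr 1; omega
  have h3 : (ρ - 1 / 2) ^ (2 * k) ≠ 0 := pow_ne_zero _ hρ
  rw [h2]
  generalize ρ - 1 / 2 = w at *
  field_simp

lemma summable_powerTerm (a : ℝ) (n : ℕ) :
    Summable fun ρ : nontrivialZeros => (zeroMultiplicity ρ : ℂ) * powerTerm a n ρ := by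
  have h : Summable fun ρ : nontrivialZeros => -∑ k ∈ Finset.range n, (coeffA a k n : ℂ) *
      ((zeroMultiplicity ρ : ℂ) * (((ρ : ℂ) - 1 / 2) ^ (2 * (n - k)))⁻¹) := by
    refine (summable_sum fun k hk => ?_).neg
    have hk' : k < n := Finset.mem_range.mp hk
    exact (summable_zeroMultiplicity_mul_inv_pow (by omega)).mul_left _
  refine h.congr fun ρ => ?_
  rw [powerTerm_eq_neg_sum a n (sub_half_ne_zero_of_mem ρ.2), mul_neg, Finset.mul_sum]
  congr 1
  exact Finset.sum_congr rfl fun k _ => by ring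

lemma powerSum_eq (a : ℝ) (n : ℕ) :
    powerSum a n = -∑ k ∈ Finset.range n, (coeffA a k n : ℂ) *
      ∑' ρ : nontrivialZeros, (zeroMultiplicity ρ : ℂ) * (((ρ : ℂ) - 1 / 2) ^ (2 * (n - k)))⁻¹ := by
  have hs : ∀ k ∈ Finset.range n, Summable fun ρ : nontrivialZeros => (coeffA a k n : ℂ) *
      ((zeroMultiplicity ρ : ℂ) * (((ρ : ℂ) - 1 / 2) ^ (2 * (n - k)))⁻¹) := by
    intro k hk
    have hk' : k < n := Finset.mem_range.mp hk
    exact (summable_zeroMultiplicity_mul_inv_pow (by omega)).mul_left _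
  simp_rw [← tsum_mul_left]
  rw [powerSum, ← Summable.tsum_finsetSum hs, ← tsum_neg]
  refine tsum_congr fun ρ => ?_
  rw [powerTerm_eq_neg_sum a n (sub_half_ne_zero_of_mem ρ.2), mul_neg, Finset.mul_sum]
  congr 1
  exact Finset.sum_congr rfl fun k _ => by ring

/-- By Leibniz' rule, only one term survives at the zero of the monomial. -/
lemma iteratedDeriv_sub_pow_mul {g : ℂ → ℂ} {c : ℂ} (hg : AnalyticAt ℂ g c) {j N : ℕ} (hj : j ≤ N) :
    iteratedDeriv N (fun z => (z - c) ^ j * g z) c =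
      N.descFactorial j * iteratedDeriv (N - j) g c := by
  have hp : ∀ i, iteratedDeriv i (fun z : ℂ => (z - c) ^ j) c =
      j.descFactorial i * 0 ^ (j - i) := by
    intro i
    have := congrFun (iteratedDeriv_comp_sub_const i (fun z : ℂ => z ^ j) c) c
    rw [this, iteratedDeriv_pow, sub_self]
  rw [iteratedDeriv_fun_mul (by fun_prop) hg.contDiffAt, Finset.sum_eq_single j]
  · rw [hp, Nat.descFactorial_self, Nat.sub_self, pow_zero, mul_one]
    rw [Nat.descFactorial_eq_factorial_mul_choose]
    push_cast
    ring
  · intro i _ hij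
    rw [hp]
    rcases lt_or_gt_of_ne hij with h | h
    · rw [zero_pow (by omega)]; simp
    · rw [Nat.descFactorial_of_lt h]; simp
  · intro h
    exact absurd (Finset.mem_range.mpr (by omega)) h

/-- The derivative of `F_{2n} ln ξ` is a positive multiple of the sum over zeros, since the Taylor
coefficients of `ln ξ` at `1/2` are the power sums of the zeros. -/
theorem xiDerivative_eq (a : ℝ) {n : ℕ} (hn : 1 ≤ n) :
    xiDerivative a n = 4 * n * powerSum a n := by
  have hfun : (fun z : ℂ => polyF a n z * Complex.log (riemannXi z)) = fun z =>
      ∑ k ∈ Finset.range n, (4 * (((n : ℂ) - k) * coeffA a k n)) *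
        ((z - 1 / 2) ^ (2 * k) * Complex.log (riemannXi z)) := by
    funext z
    rw [polyF, Finset.mul_sum, Finset.sum_mul]
    exact Finset.sum_congr rfl fun k _ => by ring
  have hlog := analyticAt_log_riemannXi
  have han : ∀ k : ℕ, AnalyticAt ℂ
      (fun z : ℂ => (z - 1 / 2) ^ (2 * k) * Complex.log (riemannXi z)) (1 / 2) := fun k =>
    AnalyticAt.mul (by fun_prop) hlog
  rw [xiDerivative, hfun,
    iteratedDeriv_fun_sum fun k _ => contDiffAt_const.mul (han k).contDiffAt,
    powerSum_eq, Finset.mul_sum, mul_neg, Finset.mul_sum, ← Finset.sum_neg_distrib]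
  refine Finset.sum_congr rfl fun k hk => ?_
  have hk' : k < n := Finset.mem_range.mp hk
  obtain ⟨m, rfl⟩ : ∃ m, n = k + (m + 1) := ⟨n - k - 1, by omega⟩
  rw [iteratedDeriv_const_mul _ (han k).contDiffAt, iteratedDeriv_sub_pow_mul hlog (by omega)]
  have e1 : 2 * (k + (m + 1)) - 2 * k = (2 * m + 1) + 1 := by omega
  have e2 : 2 * (k + (m + 1) - k) = (2 * m + 1) + 1 := by omega
  have e3 : 2 * (k + (m + 1)) - 1 = 2 * (k + m) + 1 := by omega
  have e4 : 2 * (k + (m + 1)) = 2 * (k + m) + 1 + 1 := by omega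
  rw [e1, e2, e3, iteratedDeriv_log_riemannXi (by omega)]
  set σ := ∑' ρ : nontrivialZeros,
    (zeroMultiplicity ρ : ℂ) * (((ρ : ℂ) - 1 / 2) ^ (2 * m + 1 + 1))⁻¹
  have hdesc : ((2 * m + 1 + 1).factorial : ℂ) * ((2 * (k + (m + 1))).descFactorial (2 * k) : ℂ) =
      ((2 * (k + m) + 1 + 1).factorial : ℂ) := by
    have := Nat.factorial_mul_descFactorial (show 2 * k ≤ 2 * (k + (m + 1)) by omega)
    rw [e1] at this
    rw [← e4]
    exact_mod_cast this
  rw [Nat.factorial_succ (2 * m + 1), Nat.factorial_succ (2 * (k + m) + 1)] at hdesc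
  have hf1 : ((2 * (k + m) + 1).factorial : ℂ) ≠ 0 := by exact_mod_cast Nat.factorial_ne_zero _
  push_cast at hdesc ⊢
  field_simp
  linear_combination (-(1 / 2) * coeffA a k (k + (m + 1)) * σ) * hdesc

/-! ### Reality of the sums -/

lemma conj_mem_nontrivialZeros {ρ : ℂ} (h : ρ ∈ nontrivialZeros) :
    (starRingEnd ℂ) ρ ∈ nontrivialZeros := by
  obtain ⟨h1, h2, h3⟩ := h
  refine ⟨by rw [riemannZeta_conj, h1, map_zero], ?_, ?_⟩
  · rintro ⟨n, hn⟩
    refine h2 ⟨n, ?_⟩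
    have := congrArg (starRingEnd ℂ) hn
    simpa [map_ofNat] using this
  · intro h
    apply h3
    have := congrArg (starRingEnd ℂ) h
    simpa using this

lemma analyticAt_conj_conj {g : ℂ → ℂ} {z : ℂ} (hg : AnalyticAt ℂ g z) :
    AnalyticAt ℂ (starRingEnd ℂ ∘ g ∘ starRingEnd ℂ) (starRingEnd ℂ z) := by
  rw [analyticAt_iff_eventually_differentiableAt] at hg ⊢
  have hcont : Tendsto (starRingEnd ℂ) (𝓝 (starRingEnd ℂ z)) (𝓝 z) := by
    have := (continuous_conj.continuousAt (x := starRingEnd ℂ z)).tendsto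
    rwa [conj_conj] at this
  filter_upwards [hcont.eventually hg] with x hx
  exact differentiableAt_conj_conj_iff.mpr hx

lemma zeroMultiplicity_conj {ρ : ℂ} (h : ρ ∈ nontrivialZeros) :
    zeroMultiplicity ((starRingEnd ℂ) ρ) = zeroMultiplicity ρ := by
  have hz : ∀ σ ∈ nontrivialZeros,
      AnalyticAt ℂ riemannZeta σ ∧ analyticOrderAt riemannZeta σ ≠ ⊤ := by
    intro σ hσ
    refine ⟨analyticOn_riemannZeta σ hσ.2.2, fun htop => ?_⟩
    have hconn : IsPreconnected ({1}ᶜ : Set ℂ) :=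
      (isConnected_compl_singleton_of_one_lt_rank (by simp) 1).isPreconnected
    have := analyticOn_riemannZeta.eqOn_zero_of_preconnected_of_eventuallyEq_zero hconn
      hσ.2.2 (analyticOrderAt_eq_top.mp htop) (show (0 : ℂ) ∈ ({1}ᶜ : Set ℂ) by simp)
    rw [riemannZeta_zero] at this
    norm_num at this
  obtain ⟨ha, ht⟩ := hz ρ h
  obtain ⟨hac, htc⟩ := hz _ (conj_mem_nontrivialZeros h)
  obtain ⟨g, hg, hg0, hev⟩ := (ha.analyticOrderNatAt_eq_iff ht).mp rfl
  rw [zeroMultiplicity, zeroMultiplicity, hac.analyticOrderNatAt_eq_iff htc]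
  refine ⟨_, analyticAt_conj_conj hg, by simpa using hg0, ?_⟩
  have hcont : Tendsto (starRingEnd ℂ) (𝓝 (starRingEnd ℂ ρ)) (𝓝 ρ) := by
    have := (continuous_conj.continuousAt (x := starRingEnd ℂ ρ)).tendsto
    rwa [conj_conj] at this
  filter_upwards [hcont.eventually hev] with z hz
  rw [riemannZeta_conj] at hz
  have := congrArg (starRingEnd ℂ) hz
  simpa using this

lemma powerTerm_conj (a : ℝ) (n : ℕ) (ρ : ℂ) :
    powerTerm a n ((starRingEnd ℂ) ρ) = (starRingEnd ℂ) (powerTerm a n ρ) := by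
  simp [powerTerm, map_sum, map_ofNat]

lemma powerSum_im (a : ℝ) (n : ℕ) : (powerSum a n).im = 0 := by
  rw [← conj_eq_iff_im]
  let e : nontrivialZeros ≃ nontrivialZeros :=
    { toFun := fun ρ => ⟨(starRingEnd ℂ) ρ, conj_mem_nontrivialZeros ρ.2⟩
      invFun := fun ρ => ⟨(starRingEnd ℂ) ρ, conj_mem_nontrivialZeros ρ.2⟩
      left_inv := fun ρ => by simp
      right_inv := fun ρ => by simp }
  rw [powerSum, conj_tsum, ← e.tsum_eq]
  refine tsum_congr fun ρ => ?_
  simp only [e, Equiv.coe_fn_mk]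
  rw [powerTerm_conj, zeroMultiplicity_conj ρ.2, map_mul, conj_conj]
  simp

/-! ### Simultaneous recurrence and negativity of sums dominated by finitely many terms -/

/-- Finitely many points of the unit circle return simultaneously, infinitely often, near `1`
under taking powers. -/
lemma frequently_half_le_re_pow {ι : Type*} (s : Finset ι) (z : ι → ℂ) (hz : ∀ i ∈ s, ‖z i‖ = 1) :
    ∃ᶠ n : ℕ in atTop, ∀ i ∈ s, 1 / 2 ≤ (z i ^ n).re := by
  rw [frequently_atTop]
  intro N
  let u : ℕ → (s → ℂ) := fun n i => z i ^ n
  have hu : ∀ n, u n ∈ Metric.closedBall (0 : s → ℂ) 1 := by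
    intro n
    rw [mem_closedBall_zero_iff, pi_norm_le_iff_of_nonneg zero_le_one]
    intro i
    simp [u, hz i i.2]
  obtain ⟨L, -, φ, hφ, hlim⟩ := tendsto_subseq_of_bounded Metric.isBounded_closedBall hu
  obtain ⟨K, hK⟩ := Metric.cauchySeq_iff'.mp hlim.cauchySeq (1 / 2) (by norm_num)
  have hdist := hK (K + N) (Nat.le_add_right _ _)
  have hge : φ K + N ≤ φ (K + N) := by
    have := hφ.add_le_nat N K
    rw [Nat.add_comm K N]
    omega
  refine ⟨φ (K + N) - φ K, by omega, fun i hi => ?_⟩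
  have h1 := (dist_le_pi_dist (u (φ (K + N))) (u (φ K)) ⟨i, hi⟩).trans_lt hdist
  simp only [u, dist_eq_norm] at h1
  obtain ⟨d, hd⟩ : ∃ d, φ (K + N) = φ K + d := ⟨φ (K + N) - φ K, by omega⟩
  rw [hd, Nat.add_sub_cancel_left]
  have h2 : z i ^ (φ K + d) - z i ^ φ K = z i ^ φ K * (z i ^ d - 1) := by ring
  rw [hd, h2, norm_mul, norm_pow, hz i hi, one_pow, one_mul] at h1
  have h3 := (abs_le.mp (abs_re_le_norm (z i ^ d - 1))).1
  rw [sub_re, one_re] at h3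
  linarith

lemma one_sub_half_pow_add_inv_pow {y : ℂ} (hy : y ≠ 0) {n : ℕ} (hn : 1 ≤ n) :
    1 - (y ^ n + y⁻¹ ^ n) / 2 =
      -((y + y⁻¹ - 2) / 2) * ((∑ j ∈ Finset.range n, y ^ j) ^ 2 * (y ^ (n - 1))⁻¹) := by
  have h1 := mul_geom_sum y n
  set G := ∑ j ∈ Finset.range n, y ^ j
  have h2 : y ^ n = y ^ (n - 1) * y := by rw [← pow_succ]; congr 1; omega
  have h3 : y ^ (n - 1) ≠ 0 := pow_ne_zero _ hy
  rw [inv_pow, h2]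
  rw [h2] at h1
  field_simp
  linear_combination ((y - 1) * G + (y ^ (n - 1) * y - 1)) * h1

lemma norm_one_sub_half_pow_add_inv_pow_le {y : ℂ} (hy : 1 ≤ ‖y‖) {n : ℕ} (hn : 1 ≤ n) :
    ‖1 - (y ^ n + y⁻¹ ^ n) / 2‖ ≤ ‖y + y⁻¹ - 2‖ * (n ^ 2 * ‖y‖ ^ (n - 1)) := by
  have hy0 : y ≠ 0 := by rintro rfl; norm_num at hy
  rw [one_sub_half_pow_add_inv_pow hy0 hn, norm_mul, norm_neg, norm_div, norm_ofNat, norm_mul,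
    norm_pow, norm_inv, norm_pow]
  have hpos : 0 < ‖y‖ ^ (n - 1) := by positivity
  have hG : ‖∑ j ∈ Finset.range n, y ^ j‖ ≤ n * ‖y‖ ^ (n - 1) := by
    refine (norm_sum_le _ _).trans ?_
    calc ∑ j ∈ Finset.range n, ‖y ^ j‖ ≤ ∑ _j ∈ Finset.range n, ‖y‖ ^ (n - 1) := by
          refine Finset.sum_le_sum fun j hj => ?_
          rw [norm_pow]
          have := Finset.mem_range.mp hj
          exact pow_le_pow_right₀ hy (by omega)
      _ = _ := by simp
  have h2 : ‖∑ j ∈ Finset.range n, y ^ j‖ ^ 2 * (‖y‖ ^ (n - 1))⁻¹ ≤ n ^ 2 * ‖y‖ ^ (n - 1) := by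
    calc _ ≤ (n * ‖y‖ ^ (n - 1)) ^ 2 * (‖y‖ ^ (n - 1))⁻¹ := by gcongr
      _ = _ := by field_simp
  have h3 : ‖y + y⁻¹ - 2‖ / 2 ≤ ‖y + y⁻¹ - 2‖ := by linarith [norm_nonneg (y + y⁻¹ - 2)]
  exact mul_le_mul h3 h2 (by positivity) (norm_nonneg _)

lemma sub_one_sq_le_norm_mul {y : ℂ} (hy : 1 ≤ ‖y‖) :
    (‖y‖ - 1) ^ 2 ≤ ‖y + y⁻¹ - 2‖ * ‖y‖ := by
  have hy0 : y ≠ 0 := by rintro rfl; norm_num at hy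
  have h1 : (y + y⁻¹ - 2) * y = (y - 1) ^ 2 := by field_simp; ring
  rw [← norm_mul, h1, norm_pow]
  have h2 := norm_sub_norm_le y 1
  rw [norm_one] at h2
  have h3 : 0 ≤ ‖y‖ - 1 := by linarith
  gcongr

/-- The heart of the converse direction, in the manner of Bombieri and Lagarias: if some `y i` lies
outside the unit circle, the finitely many of largest modulus `R` dominate the sum, and for
infinitely many `n` their `n`-th powers are simultaneously close to the positive real axis. -/
theorem exists_re_tsum_neg {ι : Type*} (m : ι → ℕ) (hm : ∀ i, 1 ≤ m i) (y : ι → ℂ)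
    (hy : ∀ i, 1 ≤ ‖y i‖) (hs : Summable fun i => (m i : ℝ) * ‖y i + (y i)⁻¹ - 2‖) {i₀ : ι}
    (h₀ : 1 < ‖y i₀‖) :
    ∃ n : ℕ, 1 ≤ n ∧ (∑' i, (m i : ℂ) * (1 - (y i ^ n + (y i)⁻¹ ^ n) / 2)).re < 0 := by
  classical
  -- only finitely many of the points have modulus at least `r > 1`
  have hfin : ∀ r : ℝ, 1 < r → {i | r ≤ ‖y i‖}.Finite := by
    intro r hr
    have hr2 : 0 < (r - 1) ^ 2 / r := by
      have : 0 < r - 1 := by linarith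
      positivity
    have hlim := hs.tendsto_cofinite_zero.eventually (gt_mem_nhds hr2)
    refine (eventually_cofinite.mp hlim).subset fun i (hi : r ≤ ‖y i‖) => ?_
    simp only [mem_ofPred_eq, not_lt]
    have h1 := sub_one_sq_le_norm_mul (hy i)
    have h2 : (1 : ℝ) ≤ m i := by exact_mod_cast hm i
    have h3 : (r - 1) ^ 2 / r ≤ (‖y i‖ - 1) ^ 2 / ‖y i‖ := by
      rw [div_le_div_iff₀ (by linarith) (by linarith)]
      nlinarith [mul_nonneg (sub_nonneg.mpr hi) (by nlinarith : 0 ≤ r * ‖y i‖ - 1)]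
    have h4 : (‖y i‖ - 1) ^ 2 / ‖y i‖ ≤ ‖y i + (y i)⁻¹ - 2‖ := by
      rwa [div_le_iff₀ (by linarith)]
    nlinarith [norm_nonneg (y i + (y i)⁻¹ - 2)]
  -- the largest modulus, and the finite set where it is attained
  obtain ⟨i₁, hi₁, hmax⟩ := (hfin _ h₀).exists_maximalFor (fun i => ‖y i‖) _ ⟨i₀, le_refl ‖y i₀‖⟩
  set R := ‖y i₁‖ with hR
  have hR1 : 1 < R := h₀.trans_le hi₁
  have hle : ∀ i, ‖y i‖ ≤ R := by
    intro i
    rcases le_total ‖y i‖ R with h | h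
    · exact h
    · exact hmax (show ‖y i₀‖ ≤ ‖y i‖ from le_trans hi₁ h) h
  have hMfin : {i | ‖y i‖ = R}.Finite := (hfin R hR1).subset fun i hi => (hi : ‖y i‖ = R).ge
  set M := hMfin.toFinset with hM
  have hmem : ∀ i, i ∈ M ↔ ‖y i‖ = R := fun i => by simp [hM]
  -- the moduli of the other points are bounded away from the largest one
  obtain ⟨r, hr1, hrR, hr⟩ : ∃ r, 1 < r ∧ r < R ∧ ∀ i, i ∉ M → ‖y i‖ ≤ r := by
    have hmid : 1 < (1 + R) / 2 := by linarith
    have hev : ∀ᶠ r in 𝓝[<] R, ∀ i ∈ (hfin _ hmid).toFinset, ‖y i‖ < R → ‖y i‖ ≤ r := by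
      refine (Finset.eventually_all _).mpr fun i _ => ?_
      by_cases h : ‖y i‖ < R
      · filter_upwards [Ioo_mem_nhdsLT h] with r hr _
        exact hr.1.le
      · exact Eventually.of_forall fun r h' => absurd h' h
    obtain ⟨r, h1, h2⟩ := (hev.and (Ioo_mem_nhdsLT (by linarith : (1 + R) / 2 < R))).exists
    refine ⟨r, by linarith [h2.1], h2.2, fun i hi => ?_⟩
    rcases le_or_gt ((1 + R) / 2) ‖y i‖ with h | h
    · exact h1 i (by simpa using h) (lt_of_le_of_ne (hle i) fun he => hi ((hmem i).mpr he))
    · linarith [h2.1]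
  set B := ∑' i, (m i : ℝ) * ‖y i + (y i)⁻¹ - 2‖ with hB
  set NM : ℝ := ∑ i ∈ M, (m i : ℝ) with hNM
  have hNM0 : 0 < NM := by
    refine Finset.sum_pos (fun i _ => by exact_mod_cast hm i) ⟨i₁, (hmem i₁).mpr rfl⟩
  -- exponential growth of the main term against the rest
  have hasymp : ∀ᶠ n : ℕ in atTop, B * (n ^ 2 * r ^ n) + NM * (3 / 2 - R ^ n / 4) < 0 := by
    have hR0 : 0 < R := by linarith
    have hq : r / R < 1 := (div_lt_one hR0).mpr hrR
    have hq0 : 0 ≤ r / R := by positivity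
    have l1 : Tendsto (fun n : ℕ => (n : ℝ) ^ 2 * (r / R) ^ n) atTop (𝓝 0) :=
      tendsto_pow_const_mul_const_pow_of_abs_lt_one 2 (by rwa [abs_of_nonneg hq0])
    have l2 : Tendsto (fun n : ℕ => (R⁻¹) ^ n) atTop (𝓝 0) :=
      tendsto_pow_atTop_nhds_zero_of_lt_one (by positivity) (inv_lt_one_of_one_lt₀ hR1)
    have l3 : Tendsto (fun n : ℕ => B * ((n : ℝ) ^ 2 * (r / R) ^ n) +
        NM * (3 / 2 * (R⁻¹) ^ n - 1 / 4)) atTop (𝓝 (B * 0 + NM * (3 / 2 * 0 - 1 / 4))) :=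
      (l1.const_mul B).add (((l2.const_mul (3 / 2)).sub_const (1 / 4)).const_mul NM)
    have hneg : B * 0 + NM * (3 / 2 * 0 - 1 / 4) < 0 := by linarith
    filter_upwards [l3.eventually (gt_mem_nhds hneg)] with n hn
    have hRn : 0 < R ^ n := by positivity
    have : B * (n ^ 2 * r ^ n) + NM * (3 / 2 - R ^ n / 4) =
        R ^ n * (B * ((n : ℝ) ^ 2 * (r / R) ^ n) + NM * (3 / 2 * (R⁻¹) ^ n - 1 / 4)) := by
      rw [div_pow, inv_pow]
      field_simp
    rw [this]
    exact mul_neg_of_pos_of_neg hRn hn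
  have hfreq := frequently_half_le_re_pow M (fun i => y i / R) fun i hi => by
    rw [norm_div, norm_real, (hmem i).mp hi, Real.norm_of_nonneg (by linarith),
      div_self (by linarith)]
  obtain ⟨n, ⟨hrec, hneg⟩, hn⟩ := ((hfreq.and_eventually hasymp).and_eventually
    (eventually_ge_atTop 1)).exists
  refine ⟨n, hn, ?_⟩
  have hsum : Summable fun i => (m i : ℂ) * (1 - (y i ^ n + (y i)⁻¹ ^ n) / 2) := by
    refine Summable.of_norm_bounded (hs.mul_right (n ^ 2 * R ^ (n - 1))) fun i => ?_
    rw [norm_mul, norm_natCast, mul_assoc]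
    have h1 := norm_one_sub_half_pow_add_inv_pow_le (hy i) hn
    have h2 := hle i
    refine mul_le_mul_of_nonneg_left (h1.trans ?_) (Nat.cast_nonneg _)
    gcongr
  have hpoint : ∀ i, ((m i : ℂ) * (1 - (y i ^ n + (y i)⁻¹ ^ n) / 2)).re ≤
      (m i : ℝ) * ‖y i + (y i)⁻¹ - 2‖ * (n ^ 2 * r ^ n) +
        (if i ∈ M then (m i : ℝ) * (3 / 2 - R ^ n / 4) else 0) := by
    intro i
    have hm0 : (0 : ℝ) ≤ m i := Nat.cast_nonneg _
    rw [← ofReal_natCast, re_ofReal_mul]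
    split_ifs with hi
    · have h1 := hrec i hi
      rw [div_pow, ← ofReal_pow, div_ofReal_re, le_div_iff₀ (by positivity)] at h1
      have h2 : ((y i)⁻¹ ^ n).re ≥ -1 := by
        have h3 := (abs_le.mp (abs_re_le_norm ((y i)⁻¹ ^ n))).1
        have h4 : ‖(y i)⁻¹ ^ n‖ ≤ 1 := by
          rw [norm_pow, norm_inv]
          exact pow_le_one₀ (by positivity) (inv_le_one_of_one_le₀ (hy i))
        linarith
      have h5 : (1 - (y i ^ n + (y i)⁻¹ ^ n) / 2).re =
          1 - ((y i ^ n).re + ((y i)⁻¹ ^ n).re) / 2 := by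
        simp
      rw [h5]
      have h6 : (m i : ℝ) * (1 - ((y i ^ n).re + ((y i)⁻¹ ^ n).re) / 2) ≤
          m i * (3 / 2 - R ^ n / 4) :=
        mul_le_mul_of_nonneg_left (by linarith) hm0
      have h7 : 0 ≤ (m i : ℝ) * ‖y i + (y i)⁻¹ - 2‖ * (n ^ 2 * r ^ n) := by positivity
      linarith
    · rw [add_zero, mul_assoc]
      gcongr
      refine (re_le_norm _).trans ((norm_one_sub_half_pow_add_inv_pow_le (hy i) hn).trans ?_)
      have h1 : ‖y i‖ ^ (n - 1) ≤ r ^ n :=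
        (pow_le_pow_left₀ (norm_nonneg _) (hr i hi) _).trans
          (pow_le_pow_right₀ hr1.le (Nat.sub_le n 1))
      gcongr
  have hs2 : Summable fun i => if i ∈ M then (m i : ℝ) * (3 / 2 - R ^ n / 4) else 0 :=
    summable_of_ne_finset_zero (s := M) fun i hi => if_neg hi
  rw [re_tsum hsum]
  calc _ ≤ ∑' i, ((m i : ℝ) * ‖y i + (y i)⁻¹ - 2‖ * (n ^ 2 * r ^ n) +
        (if i ∈ M then (m i : ℝ) * (3 / 2 - R ^ n / 4) else 0)) :=
        Summable.tsum_le_tsum hpoint (reCLM.summable hsum) ((hs.mul_right _).add hs2)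
    _ = B * (n ^ 2 * r ^ n) + NM * (3 / 2 - R ^ n / 4) := by
        rw [(hs.mul_right _).tsum_add hs2, tsum_mul_right,
          tsum_eq_sum (s := M) fun i hi => if_neg hi, hNM, Finset.sum_mul]
        congr 1
        exact Finset.sum_congr rfl fun i hi => if_pos hi
    _ < 0 := hneg

/-! ### The summands as Chebyshev-type expressions -/

lemma sum_range_two_mul_add_one {M : Type*} [AddCommMonoid M] (g : ℕ → M) (n : ℕ) :
    ∑ j ∈ Finset.range (2 * n + 1), g j =
      ∑ l ∈ Finset.range (n + 1), g (2 * l) + ∑ l ∈ Finset.range n, g (2 * l + 1) := by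
  induction n with
  | zero => simp
  | succ n ih =>
    rw [show 2 * (n + 1) + 1 = 2 * n + 1 + 1 + 1 by ring, Finset.sum_range_succ,
      Finset.sum_range_succ, ih, Finset.sum_range_succ (fun l => g (2 * l)) (n + 1),
      Finset.sum_range_succ (fun l => g (2 * l + 1)) n, show 2 * n + 1 + 1 = 2 * (n + 1) by ring]
    abel

lemma one_add_pow_add_one_sub_pow (s : ℂ) (n : ℕ) :
    (1 + s) ^ (2 * n) + (1 - s) ^ (2 * n) =
      2 * ∑ l ∈ Finset.range (n + 1), ((2 * n).choose (2 * l) : ℂ) * (s ^ 2) ^ l := by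
  have h1 : (1 + s) ^ (2 * n) =
      ∑ j ∈ Finset.range (2 * n + 1), s ^ j * ((2 * n).choose j : ℂ) := by
    rw [add_comm, add_pow]; simp
  have h2 : (1 - s) ^ (2 * n) =
      ∑ j ∈ Finset.range (2 * n + 1), (-s) ^ j * ((2 * n).choose j : ℂ) := by
    rw [sub_eq_add_neg, add_comm, add_pow]; simp
  rw [h1, h2, ← Finset.sum_add_distrib, sum_range_two_mul_add_one]
  have h3 : ∑ l ∈ Finset.range n, (s ^ (2 * l + 1) * ((2 * n).choose (2 * l + 1) : ℂ) +
      (-s) ^ (2 * l + 1) * ((2 * n).choose (2 * l + 1) : ℂ)) = 0 := by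
    refine Finset.sum_eq_zero fun l _ => ?_
    rw [Odd.neg_pow ⟨l, rfl⟩]
    ring
  rw [h3, add_zero, Finset.mul_sum]
  refine Finset.sum_congr rfl fun l _ => ?_
  rw [Even.neg_pow ⟨l, two_mul l⟩, pow_mul]
  ring

lemma sum_coeffA_mul_pow {a : ℝ} (ha : a ≠ 0) (n : ℕ) (w : ℂ) :
    ∑ k ∈ Finset.range (n + 1), (coeffA a k n : ℂ) * w ^ (2 * k) =
      ((a : ℂ) ^ (2 * n))⁻¹ * ∑ l ∈ Finset.range (n + 1),
        ((2 * n).choose (2 * l) : ℂ) * (1 + (a : ℂ) ^ 2 * w ^ 2) ^ l := by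
  have ha' : (a : ℂ) ≠ 0 := by exact_mod_cast ha
  have h1 : ∀ k ∈ Finset.range (n + 1), (coeffA a k n : ℂ) * w ^ (2 * k) =
      ∑ l ∈ Finset.Icc k n, ((a : ℂ) ^ (2 * n))⁻¹ * (((2 * n).choose (2 * l) : ℂ) *
        (((a : ℂ) ^ 2 * w ^ 2) ^ k * (l.choose k : ℂ))) := by
    intro k _
    have hz : (a : ℂ) ^ (2 * (k : ℤ) - 2 * (n : ℤ)) =
        (a : ℂ) ^ (2 * k) * ((a : ℂ) ^ (2 * n))⁻¹ := by
      rw [zpow_sub₀ ha', div_eq_mul_inv]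
      norm_cast
    rw [coeffA]
    push_cast
    rw [hz, Finset.mul_sum, Finset.sum_mul]
    refine Finset.sum_congr rfl fun l _ => ?_
    rw [mul_pow, ← pow_mul, ← pow_mul]
    ring
  rw [Finset.sum_congr rfl h1, Finset.sum_comm' (t' := Finset.range (n + 1))
    (s' := fun l => Finset.range (l + 1)), Finset.mul_sum]
  · refine Finset.sum_congr rfl fun l _ => ?_
    rw [← Finset.mul_sum, ← Finset.mul_sum, add_comm (1 : ℂ), add_pow]
    simp
  · intro k l
    simp only [Finset.mem_range, Finset.mem_Icc]
    omega

lemma powerTerm_eq_of_sq {a : ℝ} (ha : a ≠ 0) (n : ℕ) {ρ s : ℂ}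
    (hs : s ^ 2 = 1 + (a : ℂ) ^ 2 * (ρ - 1 / 2) ^ 2) :
    powerTerm a n ρ = 1 - (((1 + s) / (a * (ρ - 1 / 2))) ^ (2 * n) +
      ((1 - s) / (a * (ρ - 1 / 2))) ^ (2 * n)) / 2 := by
  rw [powerTerm, sum_coeffA_mul_pow ha, ← hs, div_pow, div_pow, ← add_div,
    one_add_pow_add_one_sub_pow, mul_pow]
  generalize (∑ l ∈ Finset.range (n + 1), ((2 * n).choose (2 * l) : ℂ) * (s ^ 2) ^ l) = S
  rw [div_eq_mul_inv _ ((a : ℂ) ^ (2 * n) * _), mul_inv]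
  ring

lemma vorosTerm_eq {a : ℝ} (ha : a ≠ 0) (n : ℕ) (ρ : ℂ) :
    vorosTerm a n ρ = 2 * powerTerm a n ρ := by
  rw [powerTerm_eq_of_sq ha n (s := Complex.sqrt (1 + (a : ℂ) ^ 2 * (ρ - 1 / 2) ^ 2))
    (by rw [Complex.sqrt]; exact_mod_cast Complex.cpow_nat_inv_pow _ two_ne_zero), vorosTerm]
  ring

/-- If `y + 1/y = 2 + 4 / (a (ρ - 1/2))²`, then `y` is the square of one of the two bases in the
summand and `1/y` that of the other, their product being `-1`. -/
lemma powerTerm_eq_of_add_inv {a : ℝ} (ha : a ≠ 0) (n : ℕ) {ρ y : ℂ} (hρ : ρ - 1 / 2 ≠ 0)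
    (hy0 : y ≠ 0) (hy : y + y⁻¹ = 2 + 4 / (a * (ρ - 1 / 2)) ^ 2) :
    powerTerm a n ρ = 1 - (y ^ n + y⁻¹ ^ n) / 2 := by
  have ha' : (a : ℂ) ≠ 0 := by exact_mod_cast ha
  have hv0 : (a : ℂ) * (ρ - 1 / 2) ≠ 0 := mul_ne_zero ha' hρ
  have hsq : (a : ℂ) ^ 2 * (ρ - 1 / 2) ^ 2 = (a * (ρ - 1 / 2)) ^ 2 := (mul_pow _ _ _).symm
  obtain ⟨u, hu⟩ : ∃ u : ℂ, u ^ 2 = y ∧ u - u⁻¹ = 2 / (a * (ρ - 1 / 2)) := by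
    obtain ⟨u, hu⟩ := IsAlgClosed.exists_pow_nat_eq y (n := 2) (by norm_num)
    have hu0 : u ≠ 0 := by rintro rfl; exact hy0 (by simpa using hu.symm)
    have h1 : (u - u⁻¹) ^ 2 = (2 / (a * (ρ - 1 / 2))) ^ 2 := by
      have : (u - u⁻¹) ^ 2 = y + y⁻¹ - 2 := by
        rw [← hu]; field_simp; ring
      rw [this, hy, div_pow]; ring
    rcases sq_eq_sq_iff_eq_or_eq_neg.mp h1 with h | h
    · exact ⟨u, hu, h⟩
    · exact ⟨-u, by rw [neg_sq, hu], by rw [inv_neg, ← neg_sub', h, neg_neg]⟩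
  obtain ⟨hu, hu'⟩ := hu
  have hu0 : u ≠ 0 := by rintro rfl; exact hy0 (by simpa using hu.symm)
  have key := powerTerm_eq_of_sq ha n (ρ := ρ) (s := a * (ρ - 1 / 2) * u - 1)
  rw [hsq] at key
  generalize (a : ℂ) * (ρ - 1 / 2) = v at *
  have e1 : v * u ^ 2 = 2 * u + v := by
    field_simp at hu'
    linear_combination hu'
  have e2 : (1 - (v * u - 1)) / v = -u⁻¹ := by
    field_simp
    linear_combination -e1
  have e3 : (1 + (v * u - 1)) / v = u := by
    field_simp
    ring
  rw [key (by linear_combination v * e1), e2, e3, pow_mul, pow_mul, neg_sq, inv_pow, hu]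

lemma exists_one_le_norm_add_inv_eq (u : ℂ) : ∃ y : ℂ, 1 ≤ ‖y‖ ∧ y + y⁻¹ = u := by
  obtain ⟨s, hs⟩ := IsAlgClosed.exists_pow_nat_eq (u ^ 2 - 4) (n := 2) (by norm_num)
  have hprod : (u + s) / 2 * ((u - s) / 2) = 1 := by linear_combination -hs / 4
  have hinv1 : ((u + s) / 2)⁻¹ = (u - s) / 2 := inv_eq_of_mul_eq_one_right hprod
  have hinv2 : ((u - s) / 2)⁻¹ = (u + s) / 2 := inv_eq_of_mul_eq_one_left hprod
  rcases le_total 1 ‖(u + s) / 2‖ with h | h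
  · exact ⟨_, h, by rw [hinv1]; ring⟩
  · refine ⟨(u - s) / 2, ?_, by rw [hinv2]; ring⟩
    have h1 := congrArg norm hprod
    rw [norm_mul, norm_one] at h1
    nlinarith [norm_nonneg ((u - s) / 2)]

/-- The transformation sends precisely the critical line (outside a short segment) to the unit
circle. -/
lemma one_lt_norm_of_re_ne {a : ℝ} (ha : a ≠ 0) {ρ y : ℂ} (hρ : ρ.re ≠ 1 / 2) (hy1 : 1 ≤ ‖y‖)
    (hy : y + y⁻¹ = 2 + 4 / (a * (ρ - 1 / 2)) ^ 2) : 1 < ‖y‖ := by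
  refine lt_of_le_of_ne hy1 fun h => ?_
  have hconj : y⁻¹ = (starRingEnd ℂ) y := by
    rw [Complex.inv_def, normSq_eq_norm_sq, ← h]; simp
  rw [hconj, add_conj] at hy
  have hre : ((2 * y.re : ℝ) : ℂ) - 2 = ((2 * y.re - 2 : ℝ) : ℂ) := by push_cast; ring
  set w := ρ - 1 / 2 with hw
  have hwre : w.re ≠ 0 := by
    rw [hw, sub_re]; norm_num; intro h0; apply hρ; linarith
  have hw0 : w ≠ 0 := fun h0 => hwre (by rw [h0]; rfl)
  have ha' : (a : ℂ) ≠ 0 := by exact_mod_cast ha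
  have h1 : ((2 * y.re - 2 : ℝ) : ℂ) * (((a ^ 2 : ℝ) : ℂ) * w ^ 2) = ((4 : ℝ) : ℂ) := by
    rw [← hre, hy]
    push_cast
    field_simp
    ring
  have hyre : 2 * y.re - 2 ≤ 0 := by
    have := re_le_norm y
    rw [← h] at this
    linarith
  -- `w²` is a real number, and a negative one
  have hsqre : (w ^ 2).re = w.re ^ 2 - w.im ^ 2 := by rw [sq, mul_re]; ring
  have hsqim : (w ^ 2).im = 2 * w.re * w.im := by rw [sq, mul_im]; ring
  have hR := congrArg Complex.re h1
  have hI := congrArg Complex.im h1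
  rw [re_ofReal_mul, re_ofReal_mul, ofReal_re, hsqre] at hR
  rw [im_ofReal_mul, im_ofReal_mul, ofReal_im, hsqim] at hI
  have hfac : (2 * y.re - 2) * a ^ 2 ≠ 0 := by
    intro h0
    rw [← mul_assoc, h0] at hR
    norm_num at hR
  have him : w.im = 0 := by
    have : (2 * y.re - 2) * a ^ 2 * (2 * w.re) * w.im = 0 := by linear_combination hI
    exact (mul_eq_zero.mp this).resolve_left (mul_ne_zero hfac (mul_ne_zero two_ne_zero hwre))
  rw [him] at hR
  nlinarith [mul_nonneg (sq_nonneg a) (sq_nonneg w.re)]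

/-- On the critical line, at height at least `1/a`, the summand is `1 - cos (n θ)`. -/
lemma powerTerm_re_nonneg {a : ℝ} (ha : 1 / 4 < a) (n : ℕ) {ρ : ℂ} (hρ : ρ ∈ nontrivialZeros)
    (hre : ρ.re = 1 / 2) : 0 ≤ (powerTerm a n ρ).re := by
  have ha0 : 0 < a := by linarith
  have hw : ρ - 1 / 2 = ρ.im * I := by
    apply Complex.ext <;> simp [hre]
  have h16 : 16 ≤ ρ.im ^ 2 := by
    have h1 := norm_mul_sub_one_ge_of_mem hρ
    have h2 : ρ * (ρ - 1) = ((-(ρ.im ^ 2 + 1 / 4) : ℝ) : ℂ) := by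
      have : ρ = ρ.im * I + 1 / 2 := by rw [← hw]; ring
      rw [show ρ * (ρ - 1) = (ρ - 1 / 2) ^ 2 - 1 / 4 by ring, hw, mul_pow, I_sq]
      push_cast
      ring
    rw [h2, norm_real, Real.norm_eq_abs, abs_neg, abs_of_nonneg (by positivity)] at h1
    linarith
  have hv : 1 ≤ a ^ 2 * ρ.im ^ 2 := by nlinarith
  set x : ℝ := 1 - 2 / (a ^ 2 * ρ.im ^ 2) with hx
  have hx1 : x ≤ 1 := by
    have : 0 < 2 / (a ^ 2 * ρ.im ^ 2) := by positivity
    linarith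
  have hx2 : -1 ≤ x := by
    have : 2 / (a ^ 2 * ρ.im ^ 2) ≤ 2 := by
      rw [div_le_iff₀ (by linarith)]; linarith
    linarith
  set θ := Real.arccos x with hθ
  have hcos : Real.cos θ = x := Real.cos_arccos hx2 hx1
  have hinv : ∀ t : ℝ, (cexp (t * I))⁻¹ = cexp (-t * I) := fun t => by
    rw [← Complex.exp_neg]; ring_nf
  have htwo : ∀ t : ℝ, cexp (t * I) + cexp (-t * I) = ((2 * Real.cos t : ℝ) : ℂ) := fun t => by
    push_cast
    rw [Complex.two_cos]
  have hy : cexp (θ * I) + (cexp (θ * I))⁻¹ = 2 + 4 / (a * (ρ - 1 / 2)) ^ 2 := by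
    have ha' : (a : ℂ) ≠ 0 := by exact_mod_cast ha0.ne'
    have him : (ρ.im : ℂ) ≠ 0 := by
      have : ρ.im ≠ 0 := by intro h0; rw [h0] at h16; norm_num at h16
      exact_mod_cast this
    rw [hinv, htwo, hcos, hx, hw, mul_pow, mul_pow, I_sq]
    push_cast
    field_simp
    ring
  rw [powerTerm_eq_of_add_inv ha0.ne' n (sub_half_ne_zero_of_mem hρ) (Complex.exp_ne_zero _) hy,
    hinv, ← Complex.exp_nat_mul, ← Complex.exp_nat_mul]
  have e1 : (n : ℂ) * (θ * I) = ((n * θ : ℝ) : ℂ) * I := by push_cast; ring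
  have e2 : (n : ℂ) * (-θ * I) = -((n * θ : ℝ) : ℂ) * I := by push_cast; ring
  rw [e1, e2, htwo]
  have e3 : (1 : ℂ) - ((2 * Real.cos (n * θ) : ℝ) : ℂ) / 2 = ((1 - Real.cos (n * θ) : ℝ) : ℂ) := by
    push_cast; ring
  rw [e3, ofReal_re]
  linarith [Real.cos_le_one (n * θ)]

/-! ### The criterion -/

lemma one_le_zeroMultiplicity {ρ : ℂ} (h : ρ ∈ nontrivialZeros) : 1 ≤ zeroMultiplicity ρ := by
  rw [zeroMultiplicity_eq h, Nat.one_le_iff_ne_zero]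
  have ht := analyticOrderAt_ne_top_of_differentiable differentiable_riemannXi
    (slitPlane_ne_zero riemannXi_one_half_mem_slitPlane) ρ
  have h0 := (differentiable_riemannXi.analyticAt ρ).analyticOrderAt_ne_zero.mpr
    (mem_nontrivialZeros_iff.mp h)
  rw [← Nat.cast_analyticOrderNatAt ht] at h0
  exact_mod_cast h0

lemma powerSum_re_nonneg_of_riemannHypothesis (hRH : RiemannHypothesis) {a : ℝ} (ha : 1 / 4 < a)
    (n : ℕ) : 0 ≤ (powerSum a n).re := by
  rw [powerSum, re_tsum (summable_powerTerm a n)]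
  refine tsum_nonneg fun ρ => ?_
  rw [← ofReal_natCast, re_ofReal_mul]
  exact mul_nonneg (Nat.cast_nonneg _)
    (powerTerm_re_nonneg ha n ρ.2 (hRH ρ ρ.2.1 ρ.2.2.1 ρ.2.2.2))

lemma riemannHypothesis_of_powerSum_re_nonneg {a : ℝ} (ha : a ≠ 0)
    (h : ∀ n : ℕ, 1 ≤ n → 0 ≤ (powerSum a n).re) : RiemannHypothesis := by
  by_contra hRH
  obtain ⟨ρ₀, h1, h2, h3, h4⟩ : ∃ ρ : ℂ, riemannZeta ρ = 0 ∧
      (¬∃ n : ℕ, ρ = -2 * ((n : ℂ) + 1)) ∧ ρ ≠ 1 ∧ ρ.re ≠ 1 / 2 := by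
    unfold RiemannHypothesis at hRH
    push Not at hRH
    obtain ⟨ρ, h1, h2, h3, h4⟩ := hRH
    exact ⟨ρ, h1, by simpa using h2, h3, h4⟩
  choose y hy1 hy using fun ρ : nontrivialZeros =>
    exists_one_le_norm_add_inv_eq (2 + 4 / ((a : ℂ) * (ρ - 1 / 2)) ^ 2)
  have hs : Summable fun ρ : nontrivialZeros =>
      (zeroMultiplicity ρ : ℝ) * ‖y ρ + (y ρ)⁻¹ - 2‖ := by
    refine (summable_zeroMultiplicity_div_sq.mul_right (4 / a ^ 2)).congr fun ρ => ?_
    rw [hy ρ, add_sub_cancel_left, norm_div, norm_pow, norm_mul, norm_real, norm_ofNat,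
      Real.norm_eq_abs, mul_pow, sq_abs]
    rw [div_eq_mul_inv 4 (a ^ 2), div_eq_mul_inv 4 (a ^ 2 * _), mul_inv]
    ring
  obtain ⟨n, hn, hneg⟩ := exists_re_tsum_neg (fun ρ : nontrivialZeros => zeroMultiplicity ρ)
    (fun ρ => one_le_zeroMultiplicity ρ.2) y hy1 hs (i₀ := ⟨ρ₀, h1, h2, h3⟩)
    (one_lt_norm_of_re_ne ha h4 (hy1 _) (hy _))
  refine not_lt.mpr (h n hn) (lt_of_eq_of_lt ?_ hneg)
  rw [powerSum]
  congr 1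
  refine tsum_congr fun ρ => ?_
  have hy0 : y ρ ≠ 0 := by
    intro h0
    have := hy1 ρ
    rw [h0, norm_zero] at this
    norm_num at this
  rw [powerTerm_eq_of_add_inv ha n (sub_half_ne_zero_of_mem ρ.2) hy0 (hy ρ)]

lemma vorosSum_eq {a : ℝ} (ha : a ≠ 0) (n : ℕ) : vorosSum a n = 2 * powerSum a n := by
  rw [vorosSum, powerSum, ← tsum_mul_left]
  refine tsum_congr fun ρ => ?_
  rw [vorosTerm_eq ha]
  ring

lemma vorosSum_re {a : ℝ} (ha : a ≠ 0) (n : ℕ) : (vorosSum a n).re = 2 * (powerSum a n).re := by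
  rw [vorosSum_eq ha, show (2 : ℂ) = ((2 : ℝ) : ℂ) by norm_num, re_ofReal_mul]

lemma xiDerivative_re (a : ℝ) {n : ℕ} (hn : 1 ≤ n) :
    (xiDerivative a n).re = 4 * n * (powerSum a n).re := by
  rw [xiDerivative_eq a hn, show (4 : ℂ) * n = ((4 * n : ℝ) : ℂ) by push_cast; rfl, re_ofReal_mul]

lemma vorosSum_re_nonneg_iff {a : ℝ} (ha : a ≠ 0) (n : ℕ) :
    0 ≤ (vorosSum a n).re ↔ 0 ≤ (powerSum a n).re := by
  rw [vorosSum_re ha]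
  exact mul_nonneg_iff_of_pos_left two_pos

lemma xiDerivative_re_nonneg_iff (a : ℝ) {n : ℕ} (hn : 1 ≤ n) :
    0 ≤ (xiDerivative a n).re ↔ 0 ≤ (powerSum a n).re := by
  rw [xiDerivative_re a hn]
  have : (0 : ℝ) < n := by exact_mod_cast hn
  exact mul_nonneg_iff_of_pos_left (by positivity)

end VorosCriterion

end

theorem theorem2 :
    -- `ln ξ` (principal branch) is analytic near `1/2`, so the derivatives below are genuine
    AnalyticAt ℂ (fun z : ℂ => Complex.log (VorosCriterion.riemannXi z)) (1 / 2) ∧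
    -- the sums converge absolutely, all the numbers are real, and the first sum can be
    -- rewritten in terms of the coefficients (the summands agree up to the factor `2`)
    (∀ a : ℝ, 1 / 4 < a → ∀ n : ℕ, 1 ≤ n →
      Summable (fun ρ : VorosCriterion.nontrivialZeros =>
        (VorosCriterion.zeroMultiplicity ρ : ℂ) * VorosCriterion.vorosTerm a n ρ) ∧
      Summable (fun ρ : VorosCriterion.nontrivialZeros =>
        (VorosCriterion.zeroMultiplicity ρ : ℂ) * VorosCriterion.powerTerm a n ρ) ∧
      (∀ ρ ∈ VorosCriterion.nontrivialZeros,
        VorosCriterion.vorosTerm a n ρ = 2 * VorosCriterion.powerTerm a n ρ) ∧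
      (VorosCriterion.vorosSum a n).im = 0 ∧
      (VorosCriterion.powerSum a n).im = 0 ∧
      (VorosCriterion.xiDerivative a n).im = 0) ∧
    -- the criterion for each fixed `a > 1/4`
    (∀ a : ℝ, 1 / 4 < a →
      [RiemannHypothesis,
        ∀ n : ℕ, 1 ≤ n → 0 ≤ (VorosCriterion.vorosSum a n).re,
        ∀ n : ℕ, 1 ≤ n → 0 ≤ (VorosCriterion.powerSum a n).re,
        ∀ n : ℕ, 1 ≤ n → 0 ≤ (VorosCriterion.xiDerivative a n).re].TFAE) ∧
    -- the criterion with all `a > 1/4` together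
    [RiemannHypothesis,
      ∀ a : ℝ, 1 / 4 < a → ∀ n : ℕ, 1 ≤ n → 0 ≤ (VorosCriterion.vorosSum a n).re,
      ∀ a : ℝ, 1 / 4 < a → ∀ n : ℕ, 1 ≤ n → 0 ≤ (VorosCriterion.powerSum a n).re,
      ∀ a : ℝ, 1 / 4 < a → ∀ n : ℕ, 1 ≤ n →
        0 ≤ (VorosCriterion.xiDerivative a n).re].TFAE := by
  open VorosCriterion in
  refine ⟨analyticAt_log_riemannXi, fun a ha n hn => ?_, fun a ha => ?_, ?_⟩
  · have ha0 : a ≠ 0 := by linarith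
    refine ⟨?_, summable_powerTerm a n, fun ρ _ => vorosTerm_eq ha0 n ρ, ?_, powerSum_im a n, ?_⟩
    · refine ((summable_powerTerm a n).mul_left 2).congr fun ρ => ?_
      rw [vorosTerm_eq ha0]
      ring
    · rw [vorosSum_eq ha0, show (2 : ℂ) = ((2 : ℝ) : ℂ) by norm_num, Complex.im_ofReal_mul,
        powerSum_im, mul_zero]
    · rw [xiDerivative_eq a hn, show (4 : ℂ) * n = ((4 * n : ℝ) : ℂ) by push_cast; rfl,
        Complex.im_ofReal_mul, powerSum_im, mul_zero]
  · have ha0 : a ≠ 0 := by linarith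
    have h13 : RiemannHypothesis ↔ ∀ n : ℕ, 1 ≤ n → 0 ≤ (powerSum a n).re :=
      ⟨fun h n _ => powerSum_re_nonneg_of_riemannHypothesis h ha n,
        riemannHypothesis_of_powerSum_re_nonneg ha0⟩
    tfae_have 1 ↔ 3 := h13
    tfae_have 2 ↔ 3 := forall₂_congr fun n _ => vorosSum_re_nonneg_iff ha0 n
    tfae_have 4 ↔ 3 := forall₂_congr fun n hn => xiDerivative_re_nonneg_iff a hn
    tfae_finish
  · tfae_have 1 ↔ 3 :=
      ⟨fun h a ha n _ => powerSum_re_nonneg_of_riemannHypothesis h ha n,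
        fun h => riemannHypothesis_of_powerSum_re_nonneg one_ne_zero (h 1 (by norm_num))⟩
    tfae_have 2 ↔ 3 := forall₄_congr fun a ha n _ => vorosSum_re_nonneg_iff (by linarith) n
    tfae_have 4 ↔ 3 := forall₄_congr fun a _ n hn => xiDerivative_re_nonneg_iff a hn
    tfae_finish
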